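/- Let $k\ge 1$ and let $\mathcal A=\{p_1,\dots,p_k,n_1,\dots,n_k\}\subset\mathbb R^3$ be a configuration of $k$ (not necessarily distinct) positive points $p_i$ and $k$ (not necessarily distinct) negative points $n_i$. Let $$L(\mathcal A)=\min_{\sigma\in S_k}\sum_{i=1}^k|p_i-n_{\sigma(i)}|$$ be the length of a minimal connection, let $D_{\mathcal A}$ be the largest Euclidean distance between two points of $\mathcal A$, and suppose (as one may after relabeling) that $L(\mathcal A)=\sum_{i=1}^k|p_i-n_i|$. There exist universal constants $C,C_0,C_1>0$ (independent of $k$, of $\mathcal A$ and of all the parameters below) such that for every $\rho\in(0,1/2)$ and every $0<\lambda<(C_0(2k)^{-6})^{1/\rho}$ there is a smooth function $\zeta_\lambda:\mathbb R^3\to\mathbb R$ with the following properties. 1. $\bigl|L(\mathcal A)-\sum_{i=1}^k(\zeta_\lambda(p_i)-\zeta_\lambda(n_i))\bigr|\le C D_{\mathcal A}(2k)^6\lambda^\rho$. 2. $|\nabla\zeta_\lambda|\le 1$ on $\mathbb R^3$. 3. There is a set $P_\lambda\subset\mathbb R^3$ such that $|\zeta_\lambda(P_\lambda)|\le 2\lambda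 k^2$ (Lebesgue measure) and such that, for every $0<\kappa<\lambda^{2\rho}/3$, the set $\{x : |\nabla\zeta_\lambda(x)|<\kappa\}\setminus P_\lambda$ can be covered by a collection $\mathfrak B_\kappa$ of at most $(2k)^8$ balls of radius $C\lambda/(\lambda^{2\rho}-3\kappa)$ for which the following holds: with $T_\kappa=\zeta_\lambda\bigl(\bigcup_{B\in\mathfrak B_\kappa}B\bigr)$, for every $t\in\mathbb R\setminus(T_\kappa\cup\zeta_\lambda(P_\lambda))$ the level set $\{x : \zeta_\lambda(x)=t\}$ is a (possibly empty) complete smooth embedded two-dimensional submanifold of $\mathbb R^3$ whose second fundamental form is bounded by $C_1(\lambda^2\kappa)^{-1}$. -/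

import Mathlib

open scoped ContDiff Topology

namespace MinConn

/-- Euclidean three-space. -/
abbrev E3 : Type := EuclideanSpace ℝ (Fin 3)

/-- Euclidean plane, the parameter domain of surfaces. -/
abbrev E2 : Type := EuclideanSpace ℝ (Fin 2)

/-- The length `L` of a minimal connection joining the positive points `p i` to the negative
points `n i`: the minimum over all permutations of the total length of the segments. -/
noncomputable def minConnLength {k : ℕ} (p n : Fin k → E3) : ℝ :=
  (Finset.univ : Finset (Equiv.Perm (Fin k))).inf' Finset.univ_nonempty
    (fun σ => ∑ i, ‖p i - n (σ i)‖)

/-- The largest distance between two points of the configuration. -/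
noncomputable def configDiam {k : ℕ} (p n : Fin k → E3) : ℝ :=
  Metric.diam (Set.range p ∪ Set.range n)

/-- `X`, restricted to the open set `U` of the plane, is a regular smooth parametrization of a
relatively open part of `S`: a smooth immersion that is a homeomorphism onto its image. -/
structure IsLocalParametrization (S : Set E3) (U : Set E2) (X : E2 → E3) : Prop where
  isOpen_source : IsOpen U
  contDiffOn : ContDiffOn ℝ ∞ X U
  immersion : ∀ q ∈ U, Function.Injective (fderiv ℝ X q)
  isEmbedding : Topology.IsEmbedding (U.domRestrict X)
  image_eq : ∃ V : Set E3, IsOpen V ∧ X '' U = S ∩ V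

/-- `S` is a smooth embedded two-dimensional submanifold of three-space (possibly empty or
disconnected): every point of `S` lies in the image of a local parametrization. -/
def IsSmoothSurface (S : Set E3) : Prop :=
  ∀ x ∈ S, ∃ (U : Set E2) (X : E2 → E3), IsLocalParametrization S U X ∧ x ∈ X '' U

/-- The intrinsic (Riemannian) distance of `S`, for the metric induced by the ambient space: the
infimum of the lengths of the `C¹` paths in `S` from `x` to `y`, and `∞` if there are none. -/
noncomputable def intrinsicEDist (S : Set E3) (x y : E3) : ENNReal :=
  ⨅ (γ : ℝ → E3) (_ : ContDiff ℝ 1 γ) (_ : ∀ s ∈ Set.Icc (0 : ℝ) 1, γ s ∈ S)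
    (_ : γ 0 = x) (_ : γ 1 = y), ∫⁻ s in Set.Icc (0 : ℝ) 1, ‖deriv γ s‖ₑ

/-- `S` is complete for its intrinsic distance: every intrinsic Cauchy sequence in `S` converges,
for the intrinsic distance, to a point of `S`. -/
def IsIntrinsicallyComplete (S : Set E3) : Prop :=
  ∀ u : ℕ → E3, (∀ m, u m ∈ S) →
    (∀ ε : ENNReal, 0 < ε → ∃ N, ∀ m ≥ N, ∀ l ≥ N, intrinsicEDist S (u m) (u l) < ε) →
    ∃ x ∈ S, Filter.Tendsto (fun m => intrinsicEDist S (u m) x) Filter.atTop (𝓝 0)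

/-- The second fundamental form of the surface parametrized by `X`, at `X q`, on the pair of
tangent vectors `dX a`, `dX b`: the component of `D²X(a, b)` normal to the tangent plane. -/
noncomputable def secondFundamentalForm (X : E2 → E3) (q a b : E2) : E3 :=
  (LinearMap.range (fderiv ℝ X q).toLinearMap)ᗮ.starProjection
    (fderiv ℝ (fderiv ℝ X) q a b)

/-- The second fundamental form `II` of `S` is bounded by `K`, i.e. `|II(v, w)| ≤ K |v| |w|` for
all tangent vectors `v`, `w` of `S` at a common point. -/
def SecondFundamentalFormBoundedBy (S : Set E3) (K : ℝ) : Prop :=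
  ∀ (U : Set E2) (X : E2 → E3), IsLocalParametrization S U X → ∀ q ∈ U, ∀ a b : E2,
    ‖secondFundamentalForm X q a b‖ ≤ K * ‖fderiv ℝ X q a‖ * ‖fderiv ℝ X q b‖

end MinConn

/-!
The proof perturbs a piecewise affine calibration and smooths it.

*Duality.* Since the identity is an optimal assignment, Kantorovich duality (`exists_dual_prices`)
gives numbers `a i`, `b j` with `a i - b j ≤ ‖p i - n j‖` and equality for `i = j`. If `v (i, j)` is the
direction of `p i - n j`, then the function `max_i min_j (a i + ⟪v (i, j), x - p i⟫)` is `1`-Lipschitz,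
at least `a i` at `p i` and at most `b j` at `n j`, so it calibrates the connection exactly. It involves
only `k ^ 2` affine functions.

*General position.* Put `s = lam ^ ρ`. A perturbation of the slopes by `O(k ^ 4 s)` ensures that the
convex hull of any three of them has distance at least `s ^ 2` from the origin
(`exists_generalPosition`): a new slope only has to avoid slabs of width `O(s)` around the at most
`k ^ 4` planes spanned by two earlier ones. As the
configuration has diameter `D`, this changes the calibration by `O(D k ^ 5 s)` in total.

*Smoothing.* Maxima and minima are replaced by smooth versions at scale `2 k lam ^ 2`. The result `ζ` has
a gradient with Lipschitz constant `O(lam ^ (-2))`, and the gradient at `x` is a convex combination of the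
slopes of those affine functions that nearly agree with `ζ` at `x` (`SoftSelection`).

*Small gradients.* Where `‖∇ζ‖ < κ`, Carathéodory's theorem leaves four slopes with a small convex
combination, and the four affine functions nearly agree. If this happens for the same four at `x` and at
`y`, then the slopes are almost constant along `x - y`; projecting along `x - y` and using Carathéodory's
theorem in the plane yields a short convex combination of three slopes, which general position forbids
unless `x` and `y` are close (`GeneralPosition.norm_sub_mul_le`). Hence one ball for each of the `k ^ 8`
quadruples of slopes suffices, and no exceptional set `P` is needed.

*Level sets.* A level set on which `‖∇ζ‖ ≥ κ` is a closed embedded surface by the inverse function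
theorem, closed embedded surfaces are complete, and differentiating `ζ ∘ X = t` twice bounds the second
fundamental form by the Lipschitz constant of the gradient divided by `κ`.

*Small configurations.* The smoothing error is within the tolerance only if `D s ≥ lam ^ 2`. Otherwise
`D < lam ^ (3 / 2)`, and composing with `y ↦ lam * sin (y / lam)` confines `ζ` to an interval of
length `2 lam` at the cost of a small error; then `P` may be the whole space.
-/

namespace MinConn

/-! ### Duality for the assignment problem -/

section Duality

variable {ι : Type*} [Fintype ι]

/-- If every permutation has nonnegative total weight, so has every circulation `x`: after scaling
and filling up the diagonal, `x` is doubly stochastic, hence a mixture of permutations. -/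
lemma sum_mul_nonneg_of_circulation [DecidableEq ι] {d x : ι → ι → ℝ} (hd : ∀ i, d i i = 0)
    (hperm : ∀ σ : Equiv.Perm ι, 0 ≤ ∑ i, d i (σ i)) (hx : ∀ i j, 0 ≤ x i j)
    (hcirc : ∀ i, ∑ j, x i j = ∑ j, x j i) : 0 ≤ ∑ i, ∑ j, x i j * d i j := by
  set t : ℝ := (1 + ∑ i, ∑ j, x i j)⁻¹ with ht
  have hS : 0 ≤ ∑ i, ∑ j, x i j :=
    Finset.sum_nonneg fun i _ => Finset.sum_nonneg fun j _ => hx i j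
  have ht0 : 0 < t := by positivity
  have hrow : ∀ i, t * ∑ j, x i j ≤ 1 := by
    intro i
    have h1 : ∑ j, x i j ≤ ∑ i, ∑ j, x i j :=
      Finset.single_le_sum (f := fun i => ∑ j, x i j)
        (fun i _ => Finset.sum_nonneg fun j _ => hx i j) (Finset.mem_univ i)
    rw [ht, inv_mul_le_iff₀ (by positivity)]
    linarith
  set M : Matrix ι ι ℝ :=
    fun i j => t * x i j + if i = j then 1 - t * ∑ l, x i l else 0 with hM
  have hMds : M ∈ doublyStochastic ℝ ι := by
    rw [mem_doublyStochastic_iff_sum]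
    refine ⟨fun i j => ?_, fun i => ?_, fun j => ?_⟩
    · have h1 := hrow i
      have h2 := mul_nonneg ht0.le (hx i j)
      simp only [hM]
      split_ifs <;> linarith
    · simp [hM, Finset.sum_add_distrib, ← Finset.mul_sum]
    · simp [hM, Finset.sum_add_distrib, ← Finset.mul_sum, hcirc j]
  obtain ⟨w, hw0, -, hw⟩ := exists_eq_sum_perm_of_mem_doublyStochastic hMds
  have h1 : ∑ i, ∑ j, M i j * d i j = t * ∑ i, ∑ j, x i j * d i j := by
    simp only [hM, Finset.mul_sum, add_mul, Finset.sum_add_distrib, ite_mul, zero_mul,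
      Finset.sum_ite_eq, Finset.mem_univ, if_true, hd, mul_zero, add_zero,
      mul_assoc]
  have h2 : ∑ i, ∑ j, M i j * d i j = ∑ σ, w σ * ∑ i, d i (σ i) := by
    simp only [← hw, Matrix.sum_apply, Matrix.smul_apply, smul_eq_mul, Finset.sum_mul,
      Equiv.Perm.permMatrix, PEquiv.toMatrix_apply, Equiv.toPEquiv_apply, Option.mem_some_iff]
    simp only [Finset.sum_comm (s := Finset.univ (α := ι)) (t := Finset.univ (α := Equiv.Perm ι)),
      Finset.mul_sum]
    refine Finset.sum_congr rfl fun σ _ => Finset.sum_congr rfl fun i _ => ?_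
    simp
  have h3 : 0 ≤ t * ∑ i, ∑ j, x i j * d i j := by
    rw [← h1, h2]
    exact Finset.sum_nonneg fun σ _ => mul_nonneg (hw0 σ) (hperm σ)
  exact nonneg_of_mul_nonneg_right h3 ht0

/-- The total squared violation of the constraints `b i - b j ≤ d i j` attains its minimum. It is
invariant under adding constants and controls all differences `b i - b j`. -/
lemma exists_min_violation [Nonempty ι] (d : ι → ι → ℝ) :
    ∃ b : ι → ℝ, ∀ b' : ι → ℝ,
      ∑ i, ∑ j, (max (b i - b j - d i j) 0) ^ 2 ≤
        ∑ i, ∑ j, (max (b' i - b' j - d i j) 0) ^ 2 := by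
  set Ψ : (ι → ℝ) → ℝ := fun b => ∑ i, ∑ j, (max (b i - b j - d i j) 0) ^ 2 with hΨ
  have hterm : ∀ b i j, (max (b i - b j - d i j) 0) ^ 2 ≤ Ψ b := by
    intro b i j
    refine (Finset.single_le_sum (f := fun j => (max (b i - b j - d i j) 0) ^ 2)
      (fun j _ => by positivity) (Finset.mem_univ j)).trans ?_
    exact Finset.single_le_sum (f := fun i => ∑ j, (max (b i - b j - d i j) 0) ^ 2)
      (fun i _ => Finset.sum_nonneg fun j _ => by positivity) (Finset.mem_univ i)
  have hΨ0 : 0 ≤ Ψ 0 := Finset.sum_nonneg fun i _ => Finset.sum_nonneg fun j _ => by positivity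
  set A : ℝ := ∑ i, ∑ j, |d i j| with hA
  have hdA : ∀ i j, d i j ≤ A := by
    intro i j
    refine (le_abs_self _).trans ?_
    refine (Finset.single_le_sum (f := fun j => |d i j|)
      (fun j _ => by positivity) (Finset.mem_univ j)).trans ?_
    exact Finset.single_le_sum (f := fun i => ∑ j, |d i j|)
      (fun i _ => Finset.sum_nonneg fun j _ => by positivity) (Finset.mem_univ i)
  have hA0 : 0 ≤ A := Finset.sum_nonneg fun i _ => Finset.sum_nonneg fun j _ => by positivity
  set R : ℝ := A + √(Ψ 0) with hR
  have hR0 : 0 ≤ R := by positivity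
  have hcont : Continuous Ψ := by fun_prop
  obtain ⟨b, -, hb⟩ := (isCompact_closedBall (0 : ι → ℝ) R).exists_isMinOn
    ⟨0, by simpa using hR0⟩ hcont.continuousOn
  refine ⟨b, fun b' => ?_⟩
  obtain ⟨r⟩ := ‹Nonempty ι›
  have hshift : Ψ (fun i => b' i - b' r) = Ψ b' := by simp [hΨ]
  change Ψ b ≤ Ψ b'
  rw [← hshift]
  by_cases hle : Ψ (fun i => b' i - b' r) ≤ Ψ 0
  · refine hb ?_
    rw [mem_closedBall_zero_iff, pi_norm_le_iff_of_nonneg hR0]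
    have hdiff : ∀ i j, b' i - b' j ≤ R := by
      intro i j
      have h1 := (hterm (fun i => b' i - b' r) i j).trans hle
      have h2 := Real.le_sqrt_of_sq_le h1
      have h3 := (le_max_left _ _).trans h2
      have h4 := hdA i j
      linarith
    intro i
    rw [Real.norm_eq_abs, abs_le]
    constructor <;> linarith [hdiff i r, hdiff r i]
  · exact (hb (by simpa using hR0)).trans (not_le.1 hle).le

/-- Weights whose cycles are nonnegative admit a potential. At a minimizer of the squared violation
the violations form a circulation whose total weight is minus the sum of their squares. -/
lemma exists_potential [DecidableEq ι] [Nonempty ι] {d : ι → ι → ℝ} (hd : ∀ i, d i i = 0)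
    (hperm : ∀ σ : Equiv.Perm ι, 0 ≤ ∑ i, d i (σ i)) :
    ∃ b : ι → ℝ, ∀ i j, b i - b j ≤ d i j := by
  obtain ⟨b, hb⟩ := exists_min_violation d
  set x : ι → ι → ℝ := fun i j => max (b i - b j - d i j) 0 with hx
  have hx0 : ∀ i j, 0 ≤ x i j := fun i j => le_max_right _ _
  have hvar : ∀ v : ι → ℝ, ∑ i, ∑ j, x i j * (v i - v j) = 0 := by
    intro v
    set ℓ := ∑ i, ∑ j, x i j * (v i - v j) with hℓ
    set q := ∑ i, ∑ j, (v i - v j) ^ 2 with hq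
    have hq0 : 0 ≤ q := Finset.sum_nonneg fun i _ => Finset.sum_nonneg fun j _ => sq_nonneg _
    have key : ∀ τ : ℝ, 0 ≤ 2 * τ * ℓ + τ ^ 2 * q := by
      intro τ
      have h1 := hb (fun i => b i + τ * v i)
      have h2 : ∑ i, ∑ j, (max (b i + τ * v i - (b j + τ * v j) - d i j) 0) ^ 2 ≤
          ∑ i, ∑ j, ((x i j) ^ 2 + 2 * τ * (x i j * (v i - v j)) + τ ^ 2 * (v i - v j) ^ 2) := by
        refine Finset.sum_le_sum fun i _ => Finset.sum_le_sum fun j _ => ?_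
        have h3 : b i - b j - d i j ≤ x i j := le_max_left _ _
        rcases le_total (b i + τ * v i - (b j + τ * v j) - d i j) 0 with h | h
        · rw [max_eq_right h]
          nlinarith [sq_nonneg (x i j + τ * (v i - v j))]
        · rw [max_eq_left h]
          have : b i + τ * v i - (b j + τ * v j) - d i j ≤ x i j + τ * (v i - v j) := by linarith
          nlinarith
      simp only [Finset.sum_add_distrib, ← Finset.mul_sum] at h2
      linarith
    by_contra hne
    -- A quadratic polynomial in `τ` without constant term is nonnegative only if its linear term is zero.
    have h1 := key (-ℓ / (q + 1))
    have h2 : 2 * (-ℓ / (q + 1)) * ℓ + (-ℓ / (q + 1)) ^ 2 * q =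
        -(ℓ ^ 2 * (q + 2) / (q + 1) ^ 2) := by
      field_simp
      ring
    have h3 : 0 < ℓ ^ 2 * (q + 2) / (q + 1) ^ 2 := by positivity
    linarith
  have hcirc : ∀ i, ∑ j, x i j = ∑ j, x j i := by
    intro i
    have h1 := hvar (Pi.single i 1)
    simp only [mul_sub, Finset.sum_sub_distrib, Pi.single_apply, mul_ite,
      mul_one, mul_zero, Finset.sum_ite_eq', Finset.mem_univ, if_true] at h1
    rw [Finset.sum_comm] at h1
    simp only [Finset.sum_ite_eq', Finset.mem_univ, if_true] at h1
    linarith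
  have h1 := sum_mul_nonneg_of_circulation hd hperm hx0 hcirc
  have h2 : ∑ i, ∑ j, x i j * d i j = -∑ i, ∑ j, (x i j) ^ 2 := by
    have h3 : ∀ i j, x i j * d i j = x i j * (b i - b j) - x i j ^ 2 := by
      intro i j
      rcases le_total (b i - b j - d i j) 0 with h | h
      · simp [hx, max_eq_right h]
      · simp only [hx, max_eq_left h]
        ring
    simp only [h3, Finset.sum_sub_distrib, hvar b]
    ring
  refine ⟨b, fun i j => ?_⟩
  have h3 : ∑ i, ∑ j, (x i j) ^ 2 = 0 :=
    le_antisymm (by linarith) (Finset.sum_nonneg fun i _ => Finset.sum_nonneg fun j _ => sq_nonneg _)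
  rw [Finset.sum_eq_zero_iff_of_nonneg fun i _ => Finset.sum_nonneg fun j _ => sq_nonneg _] at h3
  have h4 := h3 i (Finset.mem_univ i)
  rw [Finset.sum_eq_zero_iff_of_nonneg fun j _ => sq_nonneg _] at h4
  have h5 : x i j = 0 := by simpa using h4 j (Finset.mem_univ j)
  have h6 : b i - b j - d i j ≤ x i j := le_max_left _ _
  linarith

/-- Kantorovich duality for the assignment problem: if the identity is an optimal assignment for the
costs `c`, there are prices `a`, `b` that are feasible and exact along the identity. -/
lemma exists_dual_prices [DecidableEq ι] [Nonempty ι] {c : ι → ι → ℝ}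
    (hopt : ∀ σ : Equiv.Perm ι, ∑ i, c i i ≤ ∑ i, c i (σ i)) :
    ∃ a b : ι → ℝ, (∀ i j, a i - b j ≤ c i j) ∧ ∀ i, a i - b i = c i i := by
  obtain ⟨b, hb⟩ := exists_potential (d := fun i j => c i j - c i i) (by simp)
    (fun σ => by simpa [Finset.sum_sub_distrib] using hopt σ)
  refine ⟨fun i => c i i + b i, b, fun i j => ?_, fun i => by ring⟩
  linarith [hb i j]

end Duality

/-! ### Vectors in general position -/

section GeneralPosition

open scoped RealInnerProductSpace

/-- Finitely many planes through the origin can be avoided by a translation whose size is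
proportional to their number. A slab of width `8 s` contains at most one point of each line of a
cubic grid of mesh `16 s` in a suitable coordinate direction, so it misses most of the grid. -/
lemma exists_translate_far_from_planes (Q : Finset E3) (hQ : ∀ ν ∈ Q, ‖ν‖ = 1) {M : ℕ}
    (hM : Q.card ≤ M) (v : E3) {s : ℝ} (hs : 0 < s) :
    ∃ y : E3, ‖y‖ ≤ 32 * s * (M + 1) ∧ ∀ ν ∈ Q, 4 * s ≤ |⟪v + y, ν⟫| := by
  set m := M + 1 with hm
  set y : (Fin 3 → Fin m) → E3 := fun f => WithLp.toLp 2 (fun i => 16 * s * ((f i : ℕ) : ℝ)) with hy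
  have hynorm : ∀ f, ‖y f‖ ≤ 32 * s * (M + 1) := by
    intro f
    refine abs_le_of_sq_le_sq' ?_ (by positivity) |>.2
    rw [EuclideanSpace.real_norm_sq_eq, Fin.sum_univ_three]
    have hb : ∀ i, (16 * s * ((f i : ℕ) : ℝ)) ^ 2 ≤ (16 * s * (M + 1)) ^ 2 := by
      intro i
      have h1 : ((f i : ℕ) : ℝ) ≤ M + 1 := by exact_mod_cast (f i).2.le
      gcongr
    have h0 := hb 0
    have h1 := hb 1
    have h2 := hb 2
    simp only [hy]
    nlinarith [sq_nonneg (s * ((M : ℝ) + 1))]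
  have hbad : ∀ ν : E3, ‖ν‖ = 1 →
      (Finset.univ.filter fun f => |⟪v + y f, ν⟫| < 4 * s).card ≤ m ^ 2 := by
    intro ν hν
    obtain ⟨j, hj⟩ : ∃ j, 1 / 2 ≤ |ν j| := by
      by_contra! h
      have h1 := EuclideanSpace.real_norm_sq_eq ν
      rw [hν, Fin.sum_univ_three] at h1
      have hsq : ∀ i, ν i ^ 2 ≤ 1 / 4 := by
        intro i
        have := abs_lt.1 (h i)
        nlinarith
      linarith [hsq 0, hsq 1, hsq 2]
    have hcard : Fintype.card ({i : Fin 3 // i ≠ j} → Fin m) = m ^ 2 := by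
      simp [Fintype.card_subtype_compl]
    rw [← hcard, ← Finset.card_univ]
    refine Finset.card_le_card_of_injOn (fun f i => f i) (fun _ _ => Finset.mem_univ _) ?_
    intro f hf g hg hfg
    simp only [Finset.coe_filter, Finset.mem_univ, true_and, Set.mem_ofPred_eq] at hf hg
    have hoff : ∀ i, i ≠ j → f i = g i := fun i hi => congrFun hfg ⟨i, hi⟩
    have hdiff : ⟪v + y f, ν⟫ - ⟪v + y g, ν⟫ =
        16 * s * (((f j : ℕ) : ℝ) - ((g j : ℕ) : ℝ)) * ν j := by
      rw [← inner_sub_left, add_sub_add_left_eq_sub, PiLp.inner_apply,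
        Finset.sum_eq_single j]
      · simp [hy]
        ring
      · intro i _ hi
        simp [hy, hoff i hi]
      · simp
    have hlt : |16 * s * (((f j : ℕ) : ℝ) - ((g j : ℕ) : ℝ)) * ν j| < 8 * s := by
      rw [← hdiff]
      have := abs_sub (⟪v + y f, ν⟫) (⟪v + y g, ν⟫)
      linarith
    have hjj : f j = g j := by
      by_contra hne
      have h1 : (1 : ℝ) ≤ |((f j : ℕ) : ℝ) - ((g j : ℕ) : ℝ)| := by
        have hz : ((f j : ℕ) : ℤ) - ((g j : ℕ) : ℤ) ≠ 0 := by
          intro h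
          exact hne (Fin.ext (by omega))
        exact_mod_cast Int.one_le_abs hz
      rw [abs_mul, abs_mul, abs_of_pos (by positivity : 0 < 16 * s)] at hlt
      have h2 : 16 * s * 1 * (1 / 2) ≤
          16 * s * |((f j : ℕ) : ℝ) - ((g j : ℕ) : ℝ)| * |ν j| := by gcongr
      linarith
    funext i
    by_cases hi : i = j
    · rw [hi, hjj]
    · exact hoff i hi
  obtain ⟨f, hf⟩ : ∃ f, f ∉ Q.biUnion
      fun ν => Finset.univ.filter fun f => |⟪v + y f, ν⟫| < 4 * s := by
    by_contra! h
    have h1 : m ^ 3 ≤ M * m ^ 2 := by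
      calc m ^ 3 = (Finset.univ : Finset (Fin 3 → Fin m)).card := by simp
        _ ≤ _ := Finset.card_le_card fun f _ => h f
        _ ≤ Q.card * m ^ 2 := Finset.card_biUnion_le_card_mul _ _ _ fun ν hν => hbad ν (hQ ν hν)
        _ ≤ _ := by gcongr
    have h2 : M * m ^ 2 < m ^ 3 := by
      rw [pow_succ' m 2]
      exact Nat.mul_lt_mul_of_pos_right (Nat.lt_succ_self M) (by positivity)
    omega
  refine ⟨y f, hynorm f, fun ν hν => ?_⟩
  by_contra! h
  exact hf (Finset.mem_biUnion.2 ⟨ν, hν, by simpa using h⟩)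

/-- Any two vectors of three-space have a common unit normal. -/
lemma exists_unit_normal (a b : E3) : ∃ ν : E3, ‖ν‖ = 1 ∧ ⟪a, ν⟫ = 0 ∧ ⟪b, ν⟫ = 0 := by
  set K := Submodule.span ℝ ((({a, b} : Finset E3)) : Set E3) with hK
  have hK2 : Module.finrank ℝ K ≤ 2 := (finrank_span_finset_le_card _).trans Finset.card_le_two
  have hsum := Submodule.finrank_add_finrank_orthogonal K
  have h3 : Module.finrank ℝ E3 = 3 := by simp
  have hpos : 0 < Module.finrank ℝ Kᗮ := by omega
  obtain ⟨x, hx⟩ := Module.finrank_pos_iff_exists_ne_zero.1 hpos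
  have hx0 : ‖(x : E3)‖ ≠ 0 := by simpa using hx
  have hmem : ∀ c ∈ ({a, b} : Finset E3), ⟪c, (x : E3)⟫ = 0 := fun c hc =>
    (Submodule.mem_orthogonal K x).1 x.2 c (Submodule.subset_span hc)
  refine ⟨‖(x : E3)‖⁻¹ • (x : E3), ?_, ?_, ?_⟩
  · rw [norm_smul, norm_inv, norm_norm, inv_mul_cancel₀ hx0]
  · rw [inner_smul_right, hmem a (by simp), mul_zero]
  · rw [inner_smul_right, hmem b (by simp), mul_zero]

/-- If `u` is far from a plane containing `r`, then a convex combination of `u` and `r` is not much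
shorter than `r`. -/
lemma le_norm_of_mem_segment {u r ν z : E3} {s q : ℝ} (hs : 0 < s) (hs4 : s ≤ 1 / 4) (hq : 0 ≤ q)
    (hq1 : q ≤ 1) (hν : ‖ν‖ = 1) (hr : ⟪r, ν⟫ = 0) (hu : 4 * s ≤ |⟪u, ν⟫|) (hu1 : ‖u‖ ≤ 1)
    (hrq : q ≤ ‖r‖) (hz : z ∈ segment ℝ u r) : 4 / 3 * (s * q) ≤ ‖z‖ := by
  obtain ⟨t, t', ht, ht', htt, rfl⟩ := hz
  obtain rfl : t' = 1 - t := by linarith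
  rcases le_or_gt (q / 3) t with h | h
  · have h1 : |⟪t • u + (1 - t) • r, ν⟫| ≤ ‖t • u + (1 - t) • r‖ := by
      simpa [hν] using abs_real_inner_le_norm (t • u + (1 - t) • r) ν
    rw [inner_add_left, inner_smul_left, inner_smul_left, hr, mul_zero, add_zero, abs_mul] at h1
    simp only [conj_trivial, abs_of_nonneg ht] at h1
    have h2 : q / 3 * (4 * s) ≤ t * |⟪u, ν⟫| := by gcongr
    linarith
  · have h1 : ‖(1 - t) • r‖ - ‖t • u‖ ≤ ‖t • u + (1 - t) • r‖ := by
      have := norm_sub_le (t • u + (1 - t) • r) (t • u)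
      rw [add_sub_cancel_left] at this
      linarith
    rw [norm_smul, norm_smul, Real.norm_of_nonneg ht, Real.norm_of_nonneg ht'] at h1
    nlinarith

/-- The quantitative general position of the vectors `w α`, `α ∈ S`: the convex hull of one, two or
three of them stays away from the origin by `3 / 4`, `s` and `s ^ 2`, respectively. -/
def GeneralPosition {ι : Type*} (w : ι → E3) (S : Finset ι) (s : ℝ) : Prop :=
  ∀ T ⊆ S, ∀ z ∈ convexHull ℝ (w '' T),
    (T.card ≤ 1 → 3 / 4 ≤ ‖z‖) ∧ (T.card ≤ 2 → s ≤ ‖z‖) ∧ (T.card ≤ 3 → s ^ 2 ≤ ‖z‖)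

lemma GeneralPosition.insert {ι : Type*} [DecidableEq ι] {w : ι → E3} {S : Finset ι} {s : ℝ}
    (h : GeneralPosition w S s) {δ : ι} (hs : 0 < s) (hs4 : s ≤ 1 / 4)
    (hw : ‖w δ‖ ≤ 1) (hw' : 3 / 4 ≤ ‖w δ‖)
    (hν : ∀ β ∈ S, ∀ γ ∈ S, ∃ ν : E3, ‖ν‖ = 1 ∧ ⟪w β, ν⟫ = 0 ∧ ⟪w γ, ν⟫ = 0 ∧
      4 * s ≤ |⟪w δ, ν⟫|) :
    GeneralPosition w (insert δ S) s := by
  intro T hT z hz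
  by_cases hδT : δ ∉ T
  · exact h T ((Finset.subset_insert_iff_of_notMem hδT).1 hT) z hz
  rw [not_not] at hδT
  obtain ⟨T', hδT', rfl⟩ : ∃ T', δ ∉ T' ∧ T = Insert.insert δ T' :=
    ⟨T.erase δ, Finset.notMem_erase _ _, (Finset.insert_erase hδT).symm⟩
  have hT'S : T' ⊆ S := fun β hβ => by
    rcases Finset.mem_insert.1 (hT (Finset.mem_insert_of_mem hβ)) with rfl | h'
    · exact absurd hβ hδT'
    · exact h'
  rw [Finset.card_insert_of_notMem hδT']
  rcases T'.eq_empty_or_nonempty with rfl | hne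
  · obtain rfl : z = w δ := by simpa using hz
    exact ⟨fun _ => hw', fun _ => by linarith, fun _ => by nlinarith⟩
  rw [Finset.coe_insert, Set.image_insert_eq,
    convexHull_insert ((Finset.coe_nonempty.2 hne).image w), mem_convexJoin] at hz
  obtain ⟨u, rfl, r, hr, hz⟩ := hz
  have hpos := hne.card_pos
  have hcov : T'.card ≤ 2 → ∃ ν : E3, ‖ν‖ = 1 ∧ ⟪r, ν⟫ = 0 ∧ 4 * s ≤ |⟪w δ, ν⟫| := by
    intro hcard
    obtain ⟨β, γ, hβ, hγ, hsub⟩ : ∃ β γ, β ∈ T' ∧ γ ∈ T' ∧ T' ⊆ {β, γ} := by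
      rcases (by omega : T'.card = 1 ∨ T'.card = 2) with h1 | h2
      · obtain ⟨β, rfl⟩ := Finset.card_eq_one.1 h1
        exact ⟨β, β, by simp, by simp, by simp⟩
      · obtain ⟨β, γ, -, rfl⟩ := Finset.card_eq_two.1 h2
        exact ⟨β, γ, by simp, by simp, by simp⟩
    obtain ⟨ν, h1, h2, h3, h4⟩ := hν β (hT'S hβ) γ (hT'S hγ)
    refine ⟨ν, h1, ?_, h4⟩
    have hconv : Convex ℝ {x : E3 | ⟪x, ν⟫ = 0} := by
      have : IsLinearMap ℝ fun x : E3 => ⟪x, ν⟫ :=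
        ⟨fun x y => inner_add_left x y ν, fun c x => by simp [inner_smul_left]⟩
      exact convex_hyperplane this 0
    refine convexHull_min ?_ hconv hr
    rintro _ ⟨α, hα, rfl⟩
    rcases Finset.mem_insert.1 (hsub hα) with rfl | h'
    · exact h2
    · rw [Finset.mem_singleton.1 h']
      exact h3
  refine ⟨fun hc => by omega, fun hc => ?_, fun hc => ?_⟩
  · obtain ⟨ν, h1, h2, h3⟩ := hcov (by omega)
    have := le_norm_of_mem_segment hs hs4 (by norm_num) (by norm_num) h1 h2 h3 hw
      ((h T' hT'S r hr).1 (by omega)) hz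
    linarith
  · obtain ⟨ν, h1, h2, h3⟩ := hcov (by omega)
    have := le_norm_of_mem_segment hs hs4 hs.le (by linarith) h1 h2 h3 hw
      ((h T' hT'S r hr).2.1 (by omega)) hz
    nlinarith [sq_nonneg s]

/-- Unit vectors can be moved into general position, inside the unit ball, by a perturbation
proportional to `s` and to the number of pairs. -/
lemma exists_generalPosition {ι : Type*} [Fintype ι] [DecidableEq ι] {v : ι → E3}
    (hv : ∀ α, ‖v α‖ = 1) {s R : ℝ} (hs : 0 < s)
    (hR : 32 * s * ((Fintype.card ι : ℝ) ^ 2 + 1) ≤ R) (hR8 : R ≤ 1 / 8) :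
    ∃ w : ι → E3, (∀ α, ‖w α‖ ≤ 1) ∧ (∀ α, ‖w α - v α‖ ≤ 2 * R) ∧
      GeneralPosition w Finset.univ s := by
  have hR0 : 0 ≤ R := le_trans (by positivity) hR
  have hs4 : s ≤ 1 / 4 := by nlinarith [sq_nonneg ((Fintype.card ι : ℝ))]
  suffices H : ∀ S : Finset ι, ∃ w : ι → E3, (∀ α, ‖w α‖ ≤ 1) ∧ (∀ α, ‖w α - v α‖ ≤ 2 * R) ∧
      GeneralPosition w S s from H Finset.univ
  intro S
  induction S using Finset.induction_on with
  | empty =>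
    refine ⟨v, fun α => (hv α).le, fun α => by simpa using hR0, fun T hT z hz => ?_⟩
    obtain rfl := Finset.subset_empty.1 hT
    simp at hz
  | insert δ S hδ ih =>
    obtain ⟨w, hw1, hw2, hw⟩ := ih
    choose ν hν1 hν2 hν3 using exists_unit_normal
    set Q : Finset E3 := (S ×ˢ S).image fun βγ => ν (w βγ.1) (w βγ.2) with hQ
    have hQcard : Q.card ≤ Fintype.card ι ^ 2 := by
      refine Finset.card_image_le.trans ?_
      rw [Finset.card_product, ← pow_two]
      exact Nat.pow_le_pow_left (Finset.card_le_univ S) 2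
    obtain ⟨y, hy, hyQ⟩ := exists_translate_far_from_planes Q
      (fun x hx => by
        obtain ⟨βγ, -, rfl⟩ := Finset.mem_image.1 hx
        exact hν1 _ _) hQcard ((1 - R) • v δ) hs
    have hyR : ‖y‖ ≤ R := hy.trans (by push_cast; exact hR)
    have hbase : ‖(1 - R) • v δ‖ = 1 - R := by
      rw [norm_smul, hv, Real.norm_of_nonneg (by linarith), mul_one]
    set u : E3 := (1 - R) • v δ + y with hu
    have hagree : ∀ β ∈ S, Function.update w δ u β = w β := fun β hβ =>
      Function.update_of_ne (ne_of_mem_of_not_mem hβ hδ) _ _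
    have huδ : Function.update w δ u δ = u := Function.update_self _ _ _
    have hu1 : ‖u‖ ≤ 1 := by
      have := norm_add_le ((1 - R) • v δ) y
      linarith
    refine ⟨Function.update w δ u, fun α => ?_, fun α => ?_, ?_⟩
    · by_cases hα : α = δ
      · rw [hα, huδ]
        exact hu1
      · rw [Function.update_of_ne hα]
        exact hw1 α
    · by_cases hα : α = δ
      · rw [hα, huδ]
        have h1 : u - v δ = y - R • v δ := by
          rw [hu, sub_smul, one_smul]
          abel
        have h2 := norm_sub_le y (R • v δ)
        rw [norm_smul, hv, Real.norm_of_nonneg hR0] at h2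
        rw [h1]
        linarith
      · rw [Function.update_of_ne hα]
        exact hw2 α
    · refine GeneralPosition.insert ?_ hs hs4 (by rwa [huδ]) ?_ ?_
      · intro T hT z hz
        refine hw T hT z ?_
        rwa [Set.image_congr fun β hβ => hagree β (hT hβ)] at hz
      · rw [huδ]
        have := norm_sub_le u y
        rw [hu, add_sub_cancel_right, hbase] at this
        linarith
      · intro β hβ γ hγ
        refine ⟨ν (w β) (w γ), hν1 _ _, ?_, ?_, ?_⟩
        · rw [hagree β hβ]
          exact hν2 _ _
        · rw [hagree γ hγ]
          exact hν3 _ _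
        · rw [huδ]
          exact hyQ _ (Finset.mem_image.2 ⟨(β, γ), Finset.mem_product.2 ⟨hβ, hγ⟩, rfl⟩)

end GeneralPosition

/-! ### Smooth maxima and minima -/

section Smoothing

open scoped RealInnerProductSpace
open Real (smoothTransition)

lemma deriv_smoothTransition_eq_zero {x : ℝ} (hx : x ∉ Set.Icc (0 : ℝ) 1) :
    deriv smoothTransition x = 0 := by
  rcases lt_or_ge x 0 with h | h
  · have : smoothTransition =ᶠ[𝓝 x] fun _ => 0 := by
      filter_upwards [Iio_mem_nhds h] with y hy
      exact Real.smoothTransition.zero_of_nonpos (le_of_lt hy)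
    rw [this.deriv_eq, deriv_const]
  · have h1 : 1 < x := by
      by_contra h'
      exact hx ⟨h, not_lt.1 h'⟩
    have : smoothTransition =ᶠ[𝓝 x] fun _ => 1 := by
      filter_upwards [Ioi_mem_nhds h1] with y hy
      exact Real.smoothTransition.one_of_one_le (le_of_lt hy)
    rw [this.deriv_eq, deriv_const]

lemma exists_lipschitz_smoothTransition :
    ∃ B : ℝ, 0 < B ∧ ∀ x y : ℝ, |smoothTransition x - smoothTransition y| ≤ B * |x - y| := by
  have hsmooth : ContDiff ℝ 1 smoothTransition := Real.smoothTransition.contDiff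
  obtain ⟨B, hB⟩ := isCompact_Icc.exists_bound_of_continuousOn (s := Set.Icc (0 : ℝ) 1)
    (hsmooth.continuous_deriv le_rfl).continuousOn
  refine ⟨max B 1, by positivity, fun x y => ?_⟩
  have hbound : ∀ z ∈ (Set.univ : Set ℝ), ‖deriv smoothTransition z‖ ≤ max B 1 := by
    intro z _
    by_cases hz : z ∈ Set.Icc (0 : ℝ) 1
    · exact (hB z hz).trans (le_max_left _ _)
    · rw [deriv_smoothTransition_eq_zero hz, norm_zero]
      positivity
  exact convex_univ.norm_image_sub_le_of_norm_deriv_le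
    (fun z _ => (hsmooth.differentiable one_ne_zero) z) hbound (Set.mem_univ y) (Set.mem_univ x)

/-- A smooth version of the positive part: the primitive of the smooth transition function. -/
noncomputable def softPosPart (s : ℝ) : ℝ := ∫ u in (0 : ℝ)..s, smoothTransition u

lemma hasDerivAt_softPosPart (s : ℝ) : HasDerivAt softPosPart (smoothTransition s) s :=
  intervalIntegral.integral_hasDerivAt_right
    (Real.smoothTransition.continuous.intervalIntegrable _ _)
    (Real.smoothTransition.continuous.stronglyMeasurableAtFilter _ _)
    Real.smoothTransition.continuous.continuousAt

lemma contDiff_softPosPart : ContDiff ℝ ∞ softPosPart := by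
  refine contDiff_infty_iff_deriv.2 ⟨fun s => (hasDerivAt_softPosPart s).differentiableAt, ?_⟩
  rw [funext fun s => (hasDerivAt_softPosPart s).deriv]
  exact Real.smoothTransition.contDiff

lemma softPosPart_of_nonpos {s : ℝ} (hs : s ≤ 0) : softPosPart s = 0 := by
  refine (intervalIntegral.integral_congr (g := fun _ => (0 : ℝ)) fun u hu => ?_).trans (by simp)
  rw [Set.uIcc_of_ge hs] at hu
  exact Real.smoothTransition.zero_of_nonpos hu.2

lemma softPosPart_nonneg (s : ℝ) : 0 ≤ softPosPart s := by
  rcases le_total s 0 with h | h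
  · rw [softPosPart_of_nonpos h]
  · exact intervalIntegral.integral_nonneg h fun u _ => Real.smoothTransition.nonneg u

lemma softPosPart_le {s : ℝ} (hs : 0 ≤ s) : softPosPart s ≤ s := by
  have := intervalIntegral.integral_mono_on (μ := MeasureTheory.volume) hs
    (Real.smoothTransition.continuous.intervalIntegrable 0 s)
    (Continuous.intervalIntegrable (u := fun _ => (1 : ℝ)) continuous_const 0 s)
    fun u _ => Real.smoothTransition.le_one u
  simpa [softPosPart] using this

lemma sub_one_le_softPosPart (s : ℝ) : s - 1 ≤ softPosPart s := by
  rcases le_total s 1 with h | h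
  · linarith [softPosPart_nonneg s]
  · have h1 : softPosPart s = softPosPart 1 + ∫ u in (1 : ℝ)..s, smoothTransition u :=
      (intervalIntegral.integral_add_adjacent_intervals
        (Real.smoothTransition.continuous.intervalIntegrable _ _)
        (Real.smoothTransition.continuous.intervalIntegrable _ _)).symm
    have h2 : ∫ u in (1 : ℝ)..s, smoothTransition u = s - 1 := by
      refine (intervalIntegral.integral_congr (g := fun _ => (1 : ℝ)) fun u hu => ?_).trans
        (by simp)
      rw [Set.uIcc_of_le h] at hu
      exact Real.smoothTransition.one_of_one_le hu.1
    linarith [softPosPart_nonneg 1]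

/-- A smooth version of `max a b`, which is a convex combination with constant coefficients of `a`
and `b` unless `0 < a - b < μ`. -/
noncomputable def softMax (μ a b : ℝ) : ℝ := b + μ * softPosPart ((a - b) / μ)

lemma softMax_of_le {μ a b : ℝ} (hμ : 0 < μ) (h : a ≤ b) : softMax μ a b = b := by
  rw [softMax, softPosPart_of_nonpos (div_nonpos_of_nonpos_of_nonneg (by linarith) hμ.le)]
  ring

lemma le_softMax_right {μ : ℝ} (hμ : 0 < μ) (a b : ℝ) : b ≤ softMax μ a b := by
  have := mul_nonneg hμ.le (softPosPart_nonneg ((a - b) / μ))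
  rw [softMax]
  linarith

lemma sub_le_softMax_left {μ : ℝ} (hμ : 0 < μ) (a b : ℝ) : a - μ ≤ softMax μ a b := by
  have h1 := mul_le_mul_of_nonneg_left (sub_one_le_softPosPart ((a - b) / μ)) hμ.le
  have h2 : μ * ((a - b) / μ - 1) = a - b - μ := by
    field_simp
  rw [softMax]
  linarith

lemma softMax_le_left {μ a b : ℝ} (hμ : 0 < μ) (h : b ≤ a) : softMax μ a b ≤ a := by
  have h1 := mul_le_mul_of_nonneg_left
    (softPosPart_le (s := (a - b) / μ) (div_nonneg (by linarith) hμ.le)) hμ.le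
  have h2 : μ * ((a - b) / μ) = a - b := by
    field_simp
  rw [softMax]
  linarith

variable {E : Type*} [NormedAddCommGroup E] [InnerProductSpace ℝ E] [CompleteSpace E]

lemma norm_gradient_eq_norm_fderiv (f : E → ℝ) (x : E) : ‖gradient f x‖ = ‖fderiv ℝ f x‖ := by
  rw [← toDual_gradient, LinearIsometryEquiv.norm_map]

lemma abs_sub_le_of_norm_gradient_le {f : E → ℝ} (hf : Differentiable ℝ f)
    (hgrad : ∀ x, ‖gradient f x‖ ≤ 1) (x y : E) : |f x - f y| ≤ ‖x - y‖ := by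
  have := convex_univ.norm_image_sub_le_of_norm_fderiv_le (𝕜 := ℝ) (f := f) (C := 1)
    (fun z _ => hf z) (fun z _ => (norm_gradient_eq_norm_fderiv f z).symm.trans_le (hgrad z))
    (Set.mem_univ y) (Set.mem_univ x)
  simpa using this

/-- `f` is a smooth function that approximately selects among the affine functions
`x ↦ c α + ⟪w α, x⟫`: its gradient at `x` is a convex combination of the slopes `w α` of those affine
functions whose value at `x` is within `δ` of `f x`. Moreover, the gradient is `H`-Lipschitz. -/
structure SoftSelection {ι : Type*} (w : ι → E) (c : ι → ℝ) (δ H : ℝ) (f : E → ℝ) : Prop where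
  contDiff : ContDiff ℝ ∞ f
  gradient_mem : ∀ x, gradient f x ∈ convexHull ℝ (w '' {α | |c α + ⟪w α, x⟫ - f x| ≤ δ})
  gradient_lipschitz : ∀ x y, ‖gradient f x - gradient f y‖ ≤ H * ‖x - y‖

namespace SoftSelection

variable {ι : Type*} {w : ι → E} {c : ι → ℝ} {δ H : ℝ} {f g : E → ℝ}

lemma hasGradientAt (hf : SoftSelection w c δ H f) (x : E) : HasGradientAt f (gradient f x) x :=
  (hf.contDiff.differentiable (by simp) x).hasGradientAt

lemma mono (hf : SoftSelection w c δ H f) {δ' H' : ℝ} (hδ : δ ≤ δ') (hH : H ≤ H') :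
    SoftSelection w c δ' H' f where
  contDiff := hf.contDiff
  gradient_mem x := convexHull_mono (Set.image_mono fun _ hα => le_trans hα hδ) (hf.gradient_mem x)
  gradient_lipschitz x y := (hf.gradient_lipschitz x y).trans (by gcongr)

lemma norm_gradient_le (hf : SoftSelection w c δ H f) (hw : ∀ α, ‖w α‖ ≤ 1) (x : E) :
    ‖gradient f x‖ ≤ 1 := by
  have h := convexHull_min (t := Metric.closedBall (0 : E) 1) ?_ (convex_closedBall 0 1)
    (hf.gradient_mem x)
  · simpa using h
  · rintro _ ⟨α, -, rfl⟩
    simpa using hw α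

lemma neg (hf : SoftSelection w c δ H f) : SoftSelection (-w) (-c) δ H (-f) := by
  have hgrad : ∀ x, gradient (-f) x = -gradient f x := by
    intro x
    refine HasGradientAt.gradient ?_
    rw [hasGradientAt_iff_hasFDerivAt, map_neg]
    exact (hf.hasGradientAt x).hasFDerivAt.neg
  refine ⟨hf.contDiff.neg, fun x => ?_, fun x y => ?_⟩
  · have h1 : (-w) '' {α | |(-c) α + ⟪(-w) α, x⟫ - (-f) x| ≤ δ} =
        -(w '' {α | |c α + ⟪w α, x⟫ - f x| ≤ δ}) := by
      rw [← Set.image_neg_eq_neg, Set.image_image]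
      have h2 : ∀ α, |(-c) α + ⟪(-w) α, x⟫ - (-f) x| = |c α + ⟪w α, x⟫ - f x| := by
        intro α
        rw [← abs_neg]
        simp only [Pi.neg_apply, inner_neg_left]
        congr 1
        ring
      simp only [h2]
      rfl
    rw [h1, convexHull_neg, hgrad, Set.neg_mem_neg]
    exact hf.gradient_mem x
  · rw [hgrad, hgrad, neg_sub_neg, norm_sub_rev]
    exact hf.gradient_lipschitz x y

lemma affine (w : ι → E) (c : ι → ℝ) (α : ι) :
    SoftSelection w c 0 0 fun x => c α + ⟪w α, x⟫ := by
  have hgrad : ∀ x, gradient (fun x => c α + ⟪w α, x⟫) x = w α := by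
    intro x
    refine HasGradientAt.gradient ?_
    rw [hasGradientAt_iff_hasFDerivAt]
    exact ((InnerProductSpace.toDual ℝ E) (w α)).hasFDerivAt.const_add (c α)
  refine ⟨contDiff_const.add (contDiff_const.inner ℝ contDiff_id), fun x => ?_,
    fun x y => by simp [hgrad]⟩
  rw [hgrad]
  exact subset_convexHull _ _ ⟨α, by simp, rfl⟩

lemma hasGradientAt_softMax (hf : SoftSelection w c δ H f) (hg : SoftSelection w c δ H g) {μ : ℝ}
    (hμ : 0 < μ) (x : E) :
    HasGradientAt (fun x => softMax μ (f x) (g x))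
      (smoothTransition ((f x - g x) / μ) • gradient f x +
        (1 - smoothTransition ((f x - g x) / μ)) • gradient g x) x := by
  rw [hasGradientAt_iff_hasFDerivAt]
  have hf' := (hf.hasGradientAt x).hasFDerivAt
  have hg' := (hg.hasGradientAt x).hasFDerivAt
  have h1 := (hasDerivAt_softPosPart ((f x - g x) / μ)).comp_hasFDerivAt x
    ((hf'.sub hg').const_mul μ⁻¹ |>.congr_of_eventuallyEq
      (Filter.Eventually.of_forall fun y => by
        show (f y - g y) / μ = μ⁻¹ * (f y - g y)
        rw [div_eq_inv_mul]))
  have h2 := hg'.add (h1.const_mul μ)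
  refine h2.congr_fderiv ?_
  ext v
  simp only [map_add, map_smul, add_apply, smul_apply, sub_apply, smul_eq_mul]
  field_simp
  ring

/-- Where the coefficient of a gradient in the soft maximum is nonzero, the value of the soft maximum
is within `μ` of the corresponding function, so the selection property is inherited. The transition
coefficient is `2 B / μ`-Lipschitz and multiplies a difference of two gradients, which has norm at
most `2`; this is the increment of the Lipschitz constant. -/
lemma softMax (hf : SoftSelection w c δ H f) (hg : SoftSelection w c δ H g)
    (hw : ∀ α, ‖w α‖ ≤ 1) {B : ℝ}
    (hB : ∀ x y : ℝ, |smoothTransition x - smoothTransition y| ≤ B * |x - y|) {μ : ℝ} (hμ : 0 < μ) :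
    SoftSelection w c (δ + μ) (H + 4 * B / μ) fun x => softMax μ (f x) (g x) := by
  have hgrad := fun x => (hasGradientAt_softMax hf hg hμ x).gradient
  refine ⟨?_, fun x => ?_, fun x y => ?_⟩
  · exact hg.contDiff.add (contDiff_const.mul
      (contDiff_softPosPart.comp ((hf.contDiff.sub hg.contDiff).div_const μ)))
  · rw [hgrad]
    set m := MinConn.softMax μ (f x) (g x) with hm
    have hincl : ∀ y, |y - m| ≤ μ →
        convexHull ℝ (w '' {α | |c α + ⟪w α, x⟫ - y| ≤ δ}) ⊆
          convexHull ℝ (w '' {α | |c α + ⟪w α, x⟫ - m| ≤ δ + μ}) := by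
      intro y hy
      refine convexHull_mono (Set.image_mono fun α hα => ?_)
      exact (abs_sub_le _ y _).trans (add_le_add hα hy)
    have hgm : f x - g x < μ → |g x - m| ≤ μ := by
      intro h
      have h1 := le_softMax_right hμ (f x) (g x)
      rw [abs_le]
      rcases le_total (f x) (g x) with h' | h'
      · have := softMax_of_le hμ h'
        constructor <;> linarith
      · have := softMax_le_left hμ h'
        constructor <;> linarith
    have hfm : 0 < f x - g x → |f x - m| ≤ μ := by
      intro h
      have h1 := sub_le_softMax_left hμ (f x) (g x)
      have h2 := softMax_le_left hμ (by linarith : g x ≤ f x)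
      rw [abs_le]
      constructor <;> linarith
    rcases le_or_gt (f x - g x) 0 with h | h
    · rw [Real.smoothTransition.zero_of_nonpos (div_nonpos_of_nonpos_of_nonneg h hμ.le), zero_smul,
        sub_zero, one_smul, zero_add]
      exact hincl _ (hgm (by linarith)) (hg.gradient_mem x)
    rcases le_or_gt μ (f x - g x) with h' | h'
    · rw [Real.smoothTransition.one_of_one_le ((one_le_div hμ).2 h'), one_smul,
        sub_self, zero_smul, add_zero]
      exact hincl _ (hfm h) (hf.gradient_mem x)
    · exact convex_convexHull ℝ _ (hincl _ (hfm h) (hf.gradient_mem x))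
        (hincl _ (hgm h') (hg.gradient_mem x)) (Real.smoothTransition.nonneg _)
        (sub_nonneg.2 (Real.smoothTransition.le_one _)) (by ring)
  · rw [hgrad, hgrad]
    set θ := smoothTransition ((f x - g x) / μ) with hθ
    set θ' := smoothTransition ((f y - g y) / μ) with hθ'
    have hlip : ∀ {h : E → ℝ}, SoftSelection w c δ H h → |h x - h y| ≤ ‖x - y‖ := fun hh =>
      abs_sub_le_of_norm_gradient_le (hh.contDiff.differentiable (by simp))
        (hh.norm_gradient_le hw) x y
    have hB0 : 0 ≤ B := by
      have := hB 1 0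
      simp only [sub_zero, abs_one, mul_one] at this
      exact (abs_nonneg _).trans this
    have hθθ : |θ - θ'| ≤ 2 * B / μ * ‖x - y‖ := by
      refine (hB _ _).trans ?_
      rw [← sub_div, abs_div, abs_of_pos hμ]
      have h1 : |f x - g x - (f y - g y)| ≤ 2 * ‖x - y‖ := by
        have := abs_sub (f x - f y) (g x - g y)
        rw [show f x - g x - (f y - g y) = f x - f y - (g x - g y) by ring]
        linarith [hlip hf, hlip hg]
      calc B * (|f x - g x - (f y - g y)| / μ) ≤ B * (2 * ‖x - y‖ / μ) := by gcongr
        _ = _ := by ring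
    have hθ0 : 0 ≤ θ := Real.smoothTransition.nonneg _
    have hθ1 : 0 ≤ 1 - θ := sub_nonneg.2 (Real.smoothTransition.le_one _)
    have hsplit : θ • gradient f x + (1 - θ) • gradient g x -
        (θ' • gradient f y + (1 - θ') • gradient g y) =
        θ • (gradient f x - gradient f y) + (1 - θ) • (gradient g x - gradient g y) +
          (θ - θ') • (gradient f y - gradient g y) := by
      module
    rw [hsplit]
    refine (norm_add₃_le).trans ?_
    rw [norm_smul, norm_smul, norm_smul, Real.norm_of_nonneg hθ0, Real.norm_of_nonneg hθ1,
      Real.norm_eq_abs]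
    have h1 : ‖gradient f y - gradient g y‖ ≤ 2 := by
      have := norm_sub_le (gradient f y) (gradient g y)
      linarith [hf.norm_gradient_le hw y, hg.norm_gradient_le hw y]
    have h2 := mul_le_mul_of_nonneg_left (hf.gradient_lipschitz x y) hθ0
    have h3 := mul_le_mul_of_nonneg_left (hg.gradient_lipschitz x y) hθ1
    have h4 : |θ - θ'| * ‖gradient f y - gradient g y‖ ≤ 2 * B / μ * ‖x - y‖ * 2 := by gcongr
    calc _ ≤ θ * (H * ‖x - y‖) + (1 - θ) * (H * ‖x - y‖) + 2 * B / μ * ‖x - y‖ * 2 := by linarith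
      _ = _ := by ring

/-- A finite family of functions with the selection property has a smooth maximum, obtained by
iterating the binary one. -/
lemma exists_finset_max {J : Type*} {s : Finset J} (hs : s.Nonempty) {F : J → E → ℝ}
    (hF : ∀ j ∈ s, SoftSelection w c δ H (F j)) (hw : ∀ α, ‖w α‖ ≤ 1) {B : ℝ}
    (hB : ∀ x y : ℝ, |smoothTransition x - smoothTransition y| ≤ B * |x - y|) {μ : ℝ} (hμ : 0 < μ) :
    ∃ f : E → ℝ, SoftSelection w c (δ + s.card * μ) (H + s.card * (4 * B / μ)) f ∧
      (∀ x, ∀ j ∈ s, F j x - s.card * μ ≤ f x) ∧ ∀ x, ∃ j ∈ s, f x ≤ F j x := by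
  have hB0 : 0 ≤ B := by
    have := hB 1 0
    simp only [sub_zero, abs_one, mul_one] at this
    exact (abs_nonneg _).trans this
  have hBμ : 0 ≤ 4 * B / μ := by positivity
  induction hs using Finset.Nonempty.cons_induction with
  | singleton j =>
    refine ⟨F j, (hF j (by simp)).mono ?_ ?_, fun x i hi => ?_, fun x => ⟨j, by simp, le_rfl⟩⟩
    · simpa using hμ.le
    · simpa using hBμ
    · rw [Finset.mem_singleton.1 hi]
      simpa using hμ.le
  | cons j s hj hs ih =>
    obtain ⟨f, hf, hlow, hup⟩ := ih fun i hi => hF i (Finset.mem_cons_of_mem hi)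
    refine ⟨fun x => MinConn.softMax μ (F j x) (f x), ?_, fun x i hi => ?_, fun x => ?_⟩
    · have h1 : 0 ≤ s.card * μ := by positivity
      have h2 : 0 ≤ s.card * (4 * B / μ) := by positivity
      have h3 := (hF j (Finset.mem_cons_self j s)).mono (le_add_of_nonneg_right h1)
        (le_add_of_nonneg_right h2)
      refine (h3.softMax hf hw hB hμ).mono (le_of_eq ?_) (le_of_eq ?_)
      · rw [Finset.card_cons]
        push_cast
        ring
      · rw [Finset.card_cons]
        push_cast
        ring
    · have h1 : 0 ≤ s.card * μ := by positivity
      rw [Finset.card_cons]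
      push_cast
      rcases Finset.mem_cons.1 hi with rfl | hi
      · linarith [sub_le_softMax_left hμ (F i x) (f x)]
      · linarith [le_softMax_right hμ (F j x) (f x), hlow x i hi]
    · rcases le_total (F j x) (f x) with h | h
      · obtain ⟨i, hi, hi'⟩ := hup x
        exact ⟨i, Finset.mem_cons_of_mem hi, (softMax_of_le hμ h).trans_le hi'⟩
      · exact ⟨j, Finset.mem_cons_self j s, softMax_le_left hμ h⟩

lemma exists_finset_min {J : Type*} {s : Finset J} (hs : s.Nonempty) {F : J → E → ℝ}
    (hF : ∀ j ∈ s, SoftSelection w c δ H (F j)) (hw : ∀ α, ‖w α‖ ≤ 1) {B : ℝ}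
    (hB : ∀ x y : ℝ, |smoothTransition x - smoothTransition y| ≤ B * |x - y|) {μ : ℝ} (hμ : 0 < μ) :
    ∃ f : E → ℝ, SoftSelection w c (δ + s.card * μ) (H + s.card * (4 * B / μ)) f ∧
      (∀ x, ∀ j ∈ s, f x ≤ F j x + s.card * μ) ∧ ∀ x, ∃ j ∈ s, F j x ≤ f x := by
  obtain ⟨f, hf, hlow, hup⟩ := exists_finset_max hs (F := fun j => -F j)
    (fun j hj => (hF j hj).neg) (fun α => by simpa using hw α) hB hμ
  refine ⟨-f, by simpa using hf.neg, fun x j hj => ?_, fun x => ?_⟩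
  · have := hlow x j hj
    simp only [Pi.neg_apply] at this ⊢
    linarith
  · obtain ⟨j, hj, h⟩ := hup x
    refine ⟨j, hj, ?_⟩
    simp only [Pi.neg_apply] at h ⊢
    linarith

/-- The smooth version of `max_i min_j (c (i, j) + ⟪w (i, j), x⟫)`. -/
lemma exists_max_min {J : Type*} [Fintype J] [Nonempty J] {w : J × J → E} (c : J × J → ℝ)
    (hw : ∀ α, ‖w α‖ ≤ 1) {B : ℝ}
    (hB : ∀ x y : ℝ, |smoothTransition x - smoothTransition y| ≤ B * |x - y|) {μ : ℝ} (hμ : 0 < μ) :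
    ∃ f : E → ℝ, SoftSelection w c (2 * Fintype.card J * μ)
        (2 * Fintype.card J * (4 * B / μ)) f ∧
      (∀ x i, ∃ j, c (i, j) + ⟪w (i, j), x⟫ - Fintype.card J * μ ≤ f x) ∧
      ∀ x j, ∃ i, f x ≤ c (i, j) + ⟪w (i, j), x⟫ + Fintype.card J * μ := by
  have hmin := fun i => exists_finset_min (Finset.univ_nonempty (α := J))
    (fun j _ => affine w c (i, j)) hw hB hμ
  choose g hg hup hlow using hmin
  obtain ⟨f, hf, hlow', hup'⟩ := exists_finset_max (Finset.univ_nonempty (α := J))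
    (fun i _ => hg i) hw hB hμ
  simp only [Finset.card_univ, Finset.mem_univ, true_and, forall_const] at *
  refine ⟨f, hf.mono (le_of_eq (by ring)) (le_of_eq (by ring)), fun x i => ?_, fun x j => ?_⟩
  · obtain ⟨j, hj⟩ := hlow i x
    exact ⟨j, by linarith [hlow' x i]⟩
  · obtain ⟨i, hi⟩ := hup' x
    exact ⟨i, by linarith [hup i x j]⟩

end SoftSelection

end Smoothing

/-! ### Covering the set of small gradients -/

section Covering

open scoped RealInnerProductSpace

/-- Carathéodory's theorem for the convex hull of an indexed family. -/
lemma exists_finset_of_mem_convexHull_image {E ι : Type*} [NormedAddCommGroup E]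
    [NormedSpace ℝ E] [FiniteDimensional ℝ E] {w : ι → E} {A : Set ι} {z : E}
    (hz : z ∈ convexHull ℝ (w '' A)) :
    ∃ T : Finset ι, ↑T ⊆ A ∧ T.card ≤ Module.finrank ℝ E + 1 ∧ z ∈ convexHull ℝ (w '' T) := by
  classical
  rw [convexHull_eq_union] at hz
  simp only [Set.mem_iUnion] at hz
  obtain ⟨t, htA, hind, hz⟩ := hz
  have hpre : ∀ e : t, ∃ α ∈ A, w α = e := fun e => htA e.2
  choose g hgA hg using hpre
  have himage : w '' (Finset.univ.image g : Finset ι) = t := by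
    ext e
    constructor
    · rintro ⟨α, hα, rfl⟩
      obtain ⟨e', -, rfl⟩ := Finset.mem_image.1 (Finset.mem_coe.1 hα)
      rw [hg]
      exact e'.2
    · intro he
      exact ⟨g ⟨e, he⟩, by simp, hg ⟨e, he⟩⟩
  refine ⟨Finset.univ.image g, ?_, ?_, ?_⟩
  · intro α hα
    obtain ⟨e', -, rfl⟩ := Finset.mem_image.1 (Finset.mem_coe.1 hα)
    exact hgA e'
  · have h1 := hind.card_le_finrank_succ
    have h2 := Submodule.finrank_le (vectorSpan ℝ (Set.range ((↑) : t → E)))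
    exact Finset.card_image_le.trans (by rw [Finset.card_univ]; omega)
  · rw [himage]
    exact hz

/-- If four affine functions take nearly equal values both at `x` and at `y`, then their slopes are
nearly constant along `d = x - y`. If moreover a convex combination `g` of the slopes is small, then
by Carathéodory's theorem in the plane orthogonal to `d`, some convex combination `g'` of only three
slopes differs from `g` by a small multiple of `d`. As `g'` cannot be shorter than `s ^ 2`, the
distance of `x` and `y` is bounded. -/
lemma GeneralPosition.norm_sub_mul_le {ι : Type*} [Fintype ι] {w : ι → E3} {s : ℝ}
    (hgp : GeneralPosition w Finset.univ s) {c : ι → ℝ} {T : Finset ι} {g x y : E3} {a b δ κ : ℝ}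
    (hg : g ∈ convexHull ℝ (w '' T)) (hgκ : ‖g‖ ≤ κ)
    (hx : ∀ α ∈ T, |c α + ⟪w α, x⟫ - a| ≤ δ) (hy : ∀ α ∈ T, |c α + ⟪w α, y⟫ - b| ≤ δ) :
    ‖x - y‖ * (s ^ 2 - κ) ≤ 4 * δ := by
  set d := x - y with hd
  have hT : T.Nonempty := by
    rw [Finset.nonempty_iff_ne_empty]
    rintro rfl
    simp at hg
  have hδ : 0 ≤ δ := by
    obtain ⟨α, hα⟩ := hT
    exact (abs_nonneg _).trans (hx α hα)
  rcases eq_or_ne d 0 with h0 | h0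
  · rw [h0, norm_zero, zero_mul]
    positivity
  have hconv : ∀ C r : ℝ, Convex ℝ {z : E3 | |⟪z, d⟫ - C| ≤ r} := by
    intro C r
    have hlin : IsLinearMap ℝ fun z : E3 => ⟪z, d⟫ :=
      ⟨fun u v => inner_add_left u v d, fun t u => by simp [inner_smul_left]⟩
    exact (convex_closedBall C r).is_linear_preimage hlin
  have hpair : ∀ α ∈ T, ∀ β ∈ T, |⟪w α, d⟫ - ⟪w β, d⟫| ≤ 4 * δ := by
    intro α hα β hβ
    have h1 := abs_le.1 (hx α hα)
    have h2 := abs_le.1 (hx β hβ)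
    have h3 := abs_le.1 (hy α hα)
    have h4 := abs_le.1 (hy β hβ)
    rw [hd, inner_sub_right, inner_sub_right, abs_le]
    constructor <;> linarith
  have hpair' : ∀ z ∈ convexHull ℝ (w '' T), ∀ β ∈ T, |⟪z, d⟫ - ⟪w β, d⟫| ≤ 4 * δ := by
    intro z hz β hβ
    refine convexHull_min ?_ (hconv ⟪w β, d⟫ (4 * δ)) hz
    rintro _ ⟨α, hα, rfl⟩
    exact hpair α hα β hβ
  have hpair'' : ∀ z ∈ convexHull ℝ (w '' T), |⟪z, d⟫ - ⟪g, d⟫| ≤ 4 * δ := by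
    intro z hz
    refine convexHull_min ?_ (hconv ⟪g, d⟫ (4 * δ)) hz
    rintro _ ⟨α, hα, rfl⟩
    rw [Set.mem_ofPred_eq, abs_sub_comm]
    exact hpair' g hg α hα
  set K := (Submodule.span ℝ {d})ᗮ with hK
  have hK2 : Module.finrank ℝ K = 2 := by
    have : Fact (Module.finrank ℝ E3 = 2 + 1) := ⟨by simp⟩
    exact Submodule.finrank_orthogonal_span_singleton h0
  set π := K.orthogonalProjectionOnto.toLinearMap with hπ
  have hπg : π g ∈ convexHull ℝ ((fun α => π (w α)) '' T) := by
    have := Set.mem_image_of_mem π hg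
    rwa [LinearMap.image_convexHull, Set.image_image] at this
  obtain ⟨T', hT'T, hcard, hT'⟩ := exists_finset_of_mem_convexHull_image hπg
  have hT'T : T' ⊆ T := by exact_mod_cast hT'T
  rw [hK2] at hcard
  rw [← Set.image_image π w, ← LinearMap.image_convexHull] at hT'
  obtain ⟨g', hg', hgg'⟩ := hT'
  have hlow : s ^ 2 ≤ ‖g'‖ := (hgp T' (Finset.subset_univ _) g' hg').2.2 hcard
  have hmem : g' - g ∈ Submodule.span ℝ {d} := by
    rw [← Submodule.orthogonal_orthogonal (Submodule.span ℝ {d}),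
      ← Submodule.orthogonalProjectionOnto_eq_zero_iff]
    have : π (g' - g) = 0 := by rw [map_sub, hgg', sub_self]
    exact this
  obtain ⟨t, ht⟩ := Submodule.mem_span_singleton.1 hmem
  have hd0 : 0 < ‖d‖ := norm_pos_iff.2 h0
  have ht4 : |t| * ‖d‖ ^ 2 ≤ 4 * δ := by
    have h1 := hpair'' g' (convexHull_mono (Set.image_mono hT'T) hg')
    rw [← inner_sub_left, ← ht, inner_smul_left, real_inner_self_eq_norm_sq, abs_mul] at h1
    simpa using h1
  have hnorm : ‖g'‖ ≤ κ + |t| * ‖d‖ := by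
    have h1 := norm_add_le g (t • d)
    rw [ht, add_sub_cancel, ← ht, norm_smul, Real.norm_eq_abs] at h1
    linarith
  have h1 : ‖d‖ * (s ^ 2 - κ) ≤ ‖d‖ * (|t| * ‖d‖) := by
    gcongr
    linarith
  calc _ ≤ _ := h1
    _ = |t| * ‖d‖ ^ 2 := by ring
    _ ≤ _ := ht4

/-- Every nonempty finite set with at most four elements is the range of a quadruple. -/
lemma exists_quadruple_range_eq {ι : Type*} {T : Finset ι} (hT : T.Nonempty) (hT4 : T.card ≤ 4) :
    ∃ F : Fin 4 → ι, Set.range F = T := by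
  have hne : Nonempty T := hT.to_subtype
  obtain ⟨e⟩ := Function.Embedding.nonempty_of_card_le
    (by simpa using hT4 : Fintype.card T ≤ Fintype.card (Fin 4))
  refine ⟨fun i => (Function.invFun (⇑e) i : T), ?_⟩
  change Set.range (((↑) : T → ι) ∘ Function.invFun e) = T
  rw [Set.range_comp, (Function.invFun_surjective e.injective).range_eq, Set.image_univ]
  simp

/-- The points with small gradient fall into clusters, one for each quadruple of slopes, and every
cluster is contained in a small ball. -/
lemma SoftSelection.exists_cover {ι : Type*} [Fintype ι] {w : ι → E3} {c : ι → ℝ} {δ H s κ r : ℝ}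
    {f : E3 → ℝ} (hf : SoftSelection w c δ H f) (hgp : GeneralPosition w Finset.univ s)
    (hκ : κ < s ^ 2) (hr : 4 * δ < r * (s ^ 2 - κ)) :
    ∃ centers : Finset E3, centers.card ≤ Fintype.card ι ^ 4 ∧
      {x | ‖gradient f x‖ < κ} ⊆ ⋃ c ∈ centers, Metric.ball c r := by
  classical
  set cluster : (Fin 4 → ι) → Set E3 := fun F =>
    {x | ‖gradient f x‖ < κ ∧ gradient f x ∈ convexHull ℝ (w '' Set.range F) ∧
      ∀ i, |c (F i) + ⟪w (F i), x⟫ - f x| ≤ δ} with hcluster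
  refine ⟨Finset.univ.image fun F => if h : (cluster F).Nonempty then h.some else 0, ?_, ?_⟩
  · refine Finset.card_image_le.trans ?_
    simp
  · intro x hx
    obtain ⟨T, hTA, hT4, hxT⟩ := exists_finset_of_mem_convexHull_image (hf.gradient_mem x)
    have hT : T.Nonempty := by
      rw [Finset.nonempty_iff_ne_empty]
      rintro rfl
      simp at hxT
    rw [show Module.finrank ℝ E3 = 3 by simp] at hT4
    obtain ⟨F, hF⟩ := exists_quadruple_range_eq hT hT4
    have hxF : x ∈ cluster F := by
      refine ⟨hx, by rwa [hF], fun i => hTA ?_⟩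
      rw [← hF]
      exact Set.mem_range_self i
    have hne : (cluster F).Nonempty := ⟨x, hxF⟩
    have hTF : ∀ z ∈ cluster F, ∀ α ∈ T, |c α + ⟪w α, z⟫ - f z| ≤ δ := by
      intro z hz α hα
      obtain ⟨i, rfl⟩ : α ∈ Set.range F := by
        rw [hF]
        exact hα
      exact hz.2.2 i
    have hdist := hgp.norm_sub_mul_le hxT hxF.1.le (hTF x hxF) (hTF _ hne.some_mem)
    refine Set.mem_biUnion (x := hne.some) ?_ ?_
    · refine Finset.mem_coe.2 (Finset.mem_image.2 ⟨F, Finset.mem_univ _, ?_⟩)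
      rw [dif_pos hne]
    · rw [Metric.mem_ball, dist_eq_norm]
      exact lt_of_mul_lt_mul_right (hdist.trans_lt hr) (by linarith)

end Covering

/-! ### Regular level sets -/

section LevelSets

open scoped RealInnerProductSpace

lemma injective_prod_of_transversal {A : E3 →L[ℝ] ℝ} {π : E3 →L[ℝ] E2} {ν : E3}
    (hker : ∀ v, π v = 0 → ∃ c : ℝ, v = c • ν) (hA : A ν ≠ 0) :
    Function.Injective (A.prod π) := by
  rw [injective_iff_map_eq_zero]
  intro v hv
  rw [ContinuousLinearMap.prod_apply, Prod.mk_eq_zero] at hv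
  obtain ⟨c, rfl⟩ := hker v hv.2
  rw [map_smul, smul_eq_mul, mul_eq_zero] at hv
  rw [hv.1.resolve_right hA, zero_smul]

lemma exists_equiv_prod_of_transversal {A : E3 →L[ℝ] ℝ} {π : E3 →L[ℝ] E2} {ν : E3}
    (hker : ∀ v, π v = 0 → ∃ c : ℝ, v = c • ν) (hA : A ν ≠ 0) :
    ∃ e : E3 ≃L[ℝ] ℝ × E2, (e : E3 →L[ℝ] ℝ × E2) = A.prod π := by
  have hdim : Module.finrank ℝ E3 = Module.finrank ℝ (ℝ × E2) := by simp
  refine ⟨(LinearMap.linearEquivOfInjective (A.prod π).toLinearMap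
    (injective_prod_of_transversal hker hA) hdim).toContinuousLinearEquiv, ?_⟩
  ext v <;> rfl

/-- A linear map onto the plane whose kernel is the line spanned by `ν`. -/
lemma exists_proj_of_ne_zero {ν : E3} (hν : ν ≠ 0) :
    ∃ π : E3 →L[ℝ] E2, ∀ v, π v = 0 → ∃ c : ℝ, v = c • ν := by
  have : Fact (Module.finrank ℝ E3 = 2 + 1) := ⟨by simp⟩
  set L := (OrthonormalBasis.fromOrthogonalSpanSingleton (𝕜 := ℝ) 2 hν).repr
  refine ⟨(L.toContinuousLinearEquiv : _ →L[ℝ] E2).comp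
    (Submodule.span ℝ {ν})ᗮ.orthogonalProjectionOnto, fun v hv => ?_⟩
  have h1 : (Submodule.span ℝ {ν})ᗮ.orthogonalProjectionOnto v = 0 := by
    simpa using hv
  rw [Submodule.orthogonalProjectionOnto_eq_zero_iff, Submodule.orthogonal_orthogonal,
    Submodule.mem_span_singleton] at h1
  obtain ⟨c, hc⟩ := h1
  exact ⟨c, hc.symm⟩

/-- Near a point where its gradient `ν` does not vanish, a level set is a graph over the plane
orthogonal to `ν`. -/
lemma exists_localParametrization {f : E3 → ℝ} (hf : ContDiff ℝ ∞ f) {x₀ : E3}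
    (hx₀ : gradient f x₀ ≠ 0) :
    ∃ (U : Set E2) (X : E2 → E3), IsLocalParametrization {x | f x = f x₀} U X ∧ x₀ ∈ X '' U := by
  set ν := gradient f x₀ with hν
  obtain ⟨π, hker⟩ := exists_proj_of_ne_zero hx₀
  set W : Set E3 := {x | fderiv ℝ f x ν ≠ 0} with hW
  have hWopen : IsOpen W := by
    have : Continuous fun x => fderiv ℝ f x ν :=
      (hf.continuous_fderiv (by simp)).clm_apply continuous_const
    exact isOpen_ne_fun this continuous_const
  have hx₀W : x₀ ∈ W := by
    change fderiv ℝ f x₀ ν ≠ 0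
    rw [← inner_gradient_left, ← hν]
    exact inner_self_ne_zero.2 hx₀
  set Ψ : E3 → ℝ × E2 := fun x => (f x, π x) with hΨ
  have hΨs : ContDiff ℝ ∞ Ψ := hf.prodMk π.contDiff
  have hΨd : ∀ x ∈ W, ∃ e : E3 ≃L[ℝ] ℝ × E2, HasFDerivAt Ψ (e : E3 →L[ℝ] ℝ × E2) x := by
    intro x hx
    obtain ⟨e, he⟩ := exists_equiv_prod_of_transversal hker hx
    refine ⟨e, ?_⟩
    rw [he]
    exact (hf.differentiable (by simp) x).hasFDerivAt.prodMk π.hasFDerivAt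
  obtain ⟨e₀, he₀⟩ := hΨd x₀ hx₀W
  set Φ₀ := hΨs.contDiffAt.toOpenPartialHomeomorph Ψ he₀ (by simp)
  have hx₀Φ₀ : x₀ ∈ Φ₀.source :=
    hΨs.contDiffAt.mem_toOpenPartialHomeomorph_source he₀ (by simp)
  set Φ := Φ₀.restrOpen W hWopen with hΦ
  have hΦΨ : ∀ x, Φ x = Ψ x := fun _ => rfl
  have hsource : Φ.source = Φ₀.source ∩ W := Φ₀.restrOpen_source W hWopen
  set U : Set E2 := {q | (f x₀, q) ∈ Φ.target} with hU
  set X : E2 → E3 := fun q => Φ.symm (f x₀, q) with hX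
  have hUopen : IsOpen U := Φ.open_target.preimage (by fun_prop)
  have hXs : ∀ q ∈ U, X q ∈ Φ.source := fun q hq => Φ.map_target hq
  have hright : ∀ q ∈ U, f (X q) = f x₀ ∧ π (X q) = q := by
    intro q hq
    have h1 : Ψ (X q) = (f x₀, q) := Φ.right_inv hq
    exact Prod.mk.inj h1
  have hleft : ∀ x ∈ Φ.source, f x = f x₀ → π x ∈ U ∧ X (π x) = x := by
    intro x hx hfx
    have h1 : (f x₀, π x) = Φ x := by
      rw [hΦΨ, ← hfx]
    refine ⟨?_, ?_⟩
    · change (f x₀, π x) ∈ Φ.target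
      rw [h1]
      exact Φ.map_source hx
    · change Φ.symm (f x₀, π x) = x
      rw [h1]
      exact Φ.left_inv hx
  have hXc : ∀ q ∈ U, ContDiffAt ℝ ∞ X q := by
    intro q hq
    have hmem : X q ∈ W := by
      have := hXs q hq
      rw [hsource] at this
      exact this.2
    obtain ⟨e, he⟩ := hΨd (X q) hmem
    have h1 : ContDiffAt ℝ ∞ Φ.symm (f x₀, q) := Φ.contDiffAt_symm hq he hΨs.contDiffAt
    exact h1.comp q (contDiffAt_const.prodMk contDiffAt_id)
  refine ⟨U, X, ⟨hUopen, fun q hq => (hXc q hq).contDiffWithinAt, fun q hq => ?_, ?_, ?_⟩, ?_⟩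
  · have h1 : HasFDerivAt (fun q => π (X q)) (π.comp (fderiv ℝ X q)) q :=
      π.hasFDerivAt.comp q ((hXc q hq).differentiableAt (by simp)).hasFDerivAt
    have h2 : HasFDerivAt (fun q => π (X q)) (ContinuousLinearMap.id ℝ E2) q := by
      refine (hasFDerivAt_id q).congr_of_eventuallyEq ?_
      filter_upwards [hUopen.mem_nhds hq] with q' hq'
      exact (hright q' hq').2
    have h3 := h1.unique h2
    intro a b hab
    have h4 : ∀ v, π (fderiv ℝ X q v) = v := fun v => DFunLike.congr_fun h3 v
    rw [← h4 a, ← h4 b, hab]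
  · have hXcont : Continuous (U.domRestrict X) :=
      continuousOn_iff_continuous_domRestrict.1 fun q hq => (hXc q hq).continuousAt.continuousWithinAt
    refine Topology.IsEmbedding.of_comp hXcont π.continuous ?_
    have : π ∘ U.domRestrict X = Subtype.val := funext fun q => (hright q q.2).2
    rw [this]
    exact Topology.IsEmbedding.subtypeVal
  · refine ⟨Φ.source, Φ.open_source, Set.Subset.antisymm ?_ ?_⟩
    · rintro _ ⟨q, hq, rfl⟩
      exact ⟨(hright q hq).1, hXs q hq⟩
    · rintro x ⟨hx, hxs⟩
      obtain ⟨h1, h2⟩ := hleft x hxs hx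
      exact ⟨π x, h1, h2⟩
  · have hmem : x₀ ∈ Φ.source := by
      rw [hsource]
      exact ⟨hx₀Φ₀, hx₀W⟩
    obtain ⟨h1, h2⟩ := hleft x₀ hmem rfl
    exact ⟨π x₀, h1, h2⟩

lemma isSmoothSurface_levelSet {f : E3 → ℝ} (hf : ContDiff ℝ ∞ f) {t : ℝ}
    (ht : ∀ x, f x = t → gradient f x ≠ 0) : IsSmoothSurface {x | f x = t} := by
  intro x hx
  have hx' : f x = t := hx
  have := exists_localParametrization hf (ht x hx')
  rwa [hx'] at this

lemma edist_le_intrinsicEDist (S : Set E3) (x y : E3) : edist x y ≤ intrinsicEDist S x y := by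
  refine le_iInf₂ fun γ hγ => le_iInf₂ fun _ h0 => le_iInf fun h1 => ?_
  rw [edist_comm, edist_eq_enorm_sub, ← h0, ← h1]
  exact enorm_sub_le_lintegral_deriv_of_contDiffOn_Icc hγ.contDiffOn zero_le_one

/-- In a local parametrization, the intrinsic distance to a point is at most a constant times the
distance of the parameters. The images of parameter segments are reparametrized so that they extend
to smooth curves defined for all times. -/
lemma IsLocalParametrization.exists_intrinsicEDist_le {S : Set E3} {U : Set E2} {X : E2 → E3}
    (h : IsLocalParametrization S U X) {q₀ : E2} (hq₀ : q₀ ∈ U) :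
    ∃ M r : ℝ, 0 < M ∧ 0 < r ∧ ∀ q ∈ Metric.ball q₀ r,
      intrinsicEDist S (X q) (X q₀) ≤ ENNReal.ofReal (M * dist q q₀) := by
  have hXat : ∀ q ∈ U, ContDiffAt ℝ ∞ X q := fun q hq =>
    h.contDiffOn.contDiffAt (h.isOpen_source.mem_nhds hq)
  have hcont : ContinuousAt (fderiv ℝ X) q₀ :=
    ((hXat q₀ hq₀).fderiv_right (m := 0) (by simp)).continuousAt
  have hev : ∀ᶠ q in 𝓝 q₀, q ∈ U ∧ ‖fderiv ℝ X q‖ < ‖fderiv ℝ X q₀‖ + 1 :=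
    (h.isOpen_source.eventually_mem hq₀).and
      (hcont.norm.eventually (gt_mem_nhds (lt_add_one _)))
  obtain ⟨r, hr, hball⟩ := Metric.eventually_nhds_iff_ball.1 hev
  obtain ⟨B, hB0, hB⟩ := exists_lipschitz_smoothTransition
  have hderivB : ∀ s, |deriv Real.smoothTransition s| ≤ B := fun s => by
    rw [← Real.norm_eq_abs]
    exact norm_deriv_le_of_lip' hB0.le (Filter.Eventually.of_forall fun y => hB y s)
  refine ⟨(‖fderiv ℝ X q₀‖ + 1) * B, r, by positivity, hr, fun q hq => ?_⟩
  set σ : ℝ → E2 := fun s => q + Real.smoothTransition s • (q₀ - q) with hσ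
  have hσball : ∀ s, σ s ∈ Metric.ball q₀ r := fun s =>
    (convex_ball q₀ r).add_smul_sub_mem hq (Metric.mem_ball_self hr)
      ⟨Real.smoothTransition.nonneg s, Real.smoothTransition.le_one s⟩
  have hσs : ContDiff ℝ 1 σ :=
    contDiff_const.add (Real.smoothTransition.contDiff.smul contDiff_const)
  have hγ : ContDiff ℝ 1 fun s => X (σ s) := contDiff_iff_contDiffAt.2 fun s =>
    ((hXat _ (hball _ (hσball s)).1).of_le (by simp)).comp s hσs.contDiffAt
  have hγS : ∀ s ∈ Set.Icc (0 : ℝ) 1, X (σ s) ∈ S := by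
    intro s _
    obtain ⟨V, -, hV⟩ := h.image_eq
    have : X (σ s) ∈ S ∩ V := hV ▸ Set.mem_image_of_mem X (hball _ (hσball s)).1
    exact this.1
  have hγ0 : X (σ 0) = X q := by simp [hσ]
  have hγ1 : X (σ 1) = X q₀ := by simp [hσ]
  refine (iInf₂_le_of_le (fun s => X (σ s)) hγ
    (iInf₂_le_of_le hγS hγ0 (iInf_le_of_le hγ1 le_rfl))).trans ?_
  have hderiv : ∀ s, ‖deriv (fun s => X (σ s)) s‖ₑ ≤
      ENNReal.ofReal ((‖fderiv ℝ X q₀‖ + 1) * B * dist q q₀) := by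
    intro s
    have h1 : HasDerivAt σ (deriv Real.smoothTransition s • (q₀ - q)) s :=
      (((Real.smoothTransition.contDiff (n := 1)).differentiable one_ne_zero s).hasDerivAt.smul_const
        (q₀ - q)).const_add q
    have h2 := ((hXat _ (hball _ (hσball s)).1).differentiableAt
      (by simp)).hasFDerivAt.comp_hasDerivAt s h1
    rw [← ofReal_norm]
    refine ENNReal.ofReal_le_ofReal ?_
    rw [show deriv (fun s => X (σ s)) s = _ from h2.deriv]
    refine (ContinuousLinearMap.le_opNorm _ _).trans ?_
    rw [norm_smul, dist_comm, dist_eq_norm, ← mul_assoc, Real.norm_eq_abs]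
    gcongr
    · exact (hball _ (hσball s)).2.le
    · exact hderivB s
  refine (MeasureTheory.lintegral_mono hderiv).trans ?_
  simp

/-- A closed embedded surface is complete: an intrinsic Cauchy sequence converges in space, to a
point of the surface, and near that point a local parametrization compares the distances. -/
lemma IsSmoothSurface.isIntrinsicallyComplete {S : Set E3} (hS : IsSmoothSurface S)
    (hclosed : IsClosed S) : IsIntrinsicallyComplete S := by
  intro u hu hcauchy
  have hc : CauchySeq u := by
    rw [EMetric.cauchySeq_iff]
    intro ε hε
    obtain ⟨N, hN⟩ := hcauchy ε hε
    exact ⟨N, fun m hm l hl => (edist_le_intrinsicEDist S _ _).trans_lt (hN m hm l hl)⟩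
  obtain ⟨x, hx⟩ := cauchySeq_tendsto_of_complete hc
  have hxS : x ∈ S := hclosed.mem_of_tendsto hx (Filter.Eventually.of_forall hu)
  refine ⟨x, hxS, ?_⟩
  obtain ⟨U, X, hX, q₀, hq₀, rfl⟩ := hS x hxS
  obtain ⟨M, r, hM, hr, hdist⟩ := hX.exists_intrinsicEDist_le hq₀
  rw [ENNReal.tendsto_nhds_zero]
  intro ε hε
  obtain ⟨ε', hε', hεε'⟩ : ∃ ε' : ℝ, 0 < ε' ∧ ENNReal.ofReal ε' ≤ ε := by
    rcases eq_or_ne ε ⊤ with rfl | htop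
    · exact ⟨1, one_pos, le_top⟩
    · exact ⟨ε.toReal, ENNReal.toReal_pos hε.ne' htop, ENNReal.ofReal_toReal_le⟩
  obtain ⟨V, hVopen, hV⟩ := hX.image_eq
  have hnhds := hX.isEmbedding.nhds_eq_comap ⟨q₀, hq₀⟩
  have hmem : Metric.ball (⟨q₀, hq₀⟩ : U) (min r (ε' / M)) ∈ 𝓝 (⟨q₀, hq₀⟩ : U) :=
    Metric.ball_mem_nhds _ (by positivity)
  rw [hnhds] at hmem
  obtain ⟨O, hO, hOsub⟩ := Filter.mem_comap.1 hmem
  have hxV : X q₀ ∈ V := (hV ▸ Set.mem_image_of_mem X hq₀ : X q₀ ∈ S ∩ V).2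
  have hO' : O ∈ 𝓝 (X q₀) := hO
  refine ((hx.eventually_mem hO').and (hx.eventually_mem (hVopen.mem_nhds hxV))).mono ?_
  rintro m ⟨hm, hmV⟩
  obtain ⟨q, hq, hqm⟩ : u m ∈ X '' U := by
    rw [hV]
    exact ⟨hu m, hmV⟩
  have hqO : (⟨q, hq⟩ : U) ∈ U.domRestrict X ⁻¹' O := by
    rw [← hqm] at hm
    exact hm
  have hqd := Set.mem_of_mem_of_subset hqO hOsub
  rw [Metric.mem_ball, Subtype.dist_eq] at hqd
  have hfin : M * dist q q₀ ≤ ε' := by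
    have h1 := (hqd.trans_le (min_le_right _ _)).le
    rw [le_div_iff₀ hM] at h1
    linarith
  have hr' := hdist q (Metric.mem_ball.2 (hqd.trans_le (min_le_left _ _)))
  rw [hqm] at hr'
  exact hr'.trans ((ENNReal.ofReal_le_ofReal hfin).trans hεε')

/-- A vector of the line orthogonal to a plane is determined by its inner product with a normal. -/
lemma norm_starProjection_orthogonal_mul {K : Submodule ℝ E3} (hK : Module.finrank ℝ K = 2) {N : E3}
    (hN : N ∈ Kᗮ) (v : E3) : ‖Kᗮ.starProjection v‖ * ‖N‖ = |⟪N, v⟫| := by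
  set z := Kᗮ.starProjection v with hz
  have hzK : z ∈ Kᗮ := Submodule.starProjection_apply_mem _ _
  have horth : ∀ n ∈ Kᗮ, ⟪n, v⟫ = ⟪n, z⟫ := by
    intro n hn
    have h1 := Submodule.sub_starProjection_mem_orthogonal (K := Kᗮ) v
    have h2 := (Submodule.mem_orthogonal _ _).1 h1 n hn
    rw [inner_sub_right] at h2
    linarith
  rcases eq_or_ne N 0 with rfl | hN0
  · simp
  have hone : Module.finrank ℝ Kᗮ = 1 := by
    have h1 := Submodule.finrank_add_finrank_orthogonal K
    have h2 : Module.finrank ℝ E3 = 3 := by simp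
    omega
  obtain ⟨c, hc⟩ := (finrank_eq_one_iff_of_nonzero' (⟨N, hN⟩ : Kᗮ)
    (by simpa using hN0)).1 hone ⟨z, hzK⟩
  have hc' : c • N = z := congrArg Subtype.val hc
  rw [horth N hN, ← hc', inner_smul_right, real_inner_self_eq_norm_sq, norm_smul, abs_mul,
    Real.norm_eq_abs, abs_of_nonneg (sq_nonneg ‖N‖)]
  ring

/-- Differentiating `f ∘ X = t` twice expresses the normal component of the second derivative of the
parametrization `X` through the Hessian of `f`. -/
lemma secondFundamentalFormBoundedBy_levelSet {f : E3 → ℝ} (hf : ContDiff ℝ ∞ f) {t κ H K : ℝ}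
    (hκ : 0 < κ) (ht : ∀ x, f x = t → κ ≤ ‖gradient f x‖)
    (hH : ∀ x y, ‖gradient f x - gradient f y‖ ≤ H * ‖x - y‖) (hH0 : 0 ≤ H) (hK : H ≤ K * κ) :
    SecondFundamentalFormBoundedBy {x | f x = t} K := by
  intro U X hX q hq a b
  have hXat : ∀ q ∈ U, ContDiffAt ℝ ∞ X q := fun q hq =>
    hX.contDiffOn.contDiffAt (hX.isOpen_source.mem_nhds hq)
  have hfX : ∀ q ∈ U, f (X q) = t := by
    intro q hq
    obtain ⟨V, -, hV⟩ := hX.image_eq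
    exact (hV ▸ Set.mem_image_of_mem X hq : X q ∈ {x | f x = t} ∩ V).1
  have hXd : ∀ q ∈ U, HasFDerivAt X (fderiv ℝ X q) q := fun q hq =>
    ((hXat q hq).differentiableAt (by simp)).hasFDerivAt
  have hfirst : ∀ q ∈ U, ∀ v, ⟪gradient f (X q), fderiv ℝ X q v⟫ = 0 := by
    intro q hq v
    have h1 : HasFDerivAt (fun q => f (X q)) ((fderiv ℝ f (X q)).comp (fderiv ℝ X q)) q :=
      (hf.differentiable (by simp) (X q)).hasFDerivAt.comp q (hXd q hq)
    have h2 : HasFDerivAt (fun q => f (X q)) (0 : E2 →L[ℝ] ℝ) q := by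
      refine (hasFDerivAt_const t q).congr_of_eventuallyEq ?_
      filter_upwards [hX.isOpen_source.mem_nhds hq] with q' hq'
      exact hfX q' hq'
    rw [inner_gradient_left]
    exact DFunLike.congr_fun (h1.unique h2) v
  set N := gradient f (X q) with hN
  have hNκ : κ ≤ ‖N‖ := ht _ (hfX q hq)
  have hgs : Differentiable ℝ (gradient f) := by
    have h1 : Differentiable ℝ (fderiv ℝ f) :=
      (hf.fderiv_right (m := ∞) le_rfl).differentiable (by simp)
    exact (InnerProductSpace.toDual ℝ E3).symm.toContinuousLinearEquiv.differentiable.comp h1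
  have hG : HasFDerivAt (fun q => gradient f (X q))
      ((fderiv ℝ (gradient f) (X q)).comp (fderiv ℝ X q)) q :=
    (hgs (X q)).hasFDerivAt.comp q (hXd q hq)
  have hDX : HasFDerivAt (fun q => fderiv ℝ X q b)
      ((ContinuousLinearMap.apply ℝ E3 b).comp (fderiv ℝ (fderiv ℝ X) q)) q :=
    (ContinuousLinearMap.apply ℝ E3 b).hasFDerivAt.comp q
      (((hXat q hq).fderiv_right (m := ∞) le_rfl).differentiableAt (by simp)).hasFDerivAt
  have hsecond : ⟪N, fderiv ℝ (fderiv ℝ X) q a b⟫ =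
      -⟪fderiv ℝ (gradient f) (X q) (fderiv ℝ X q a), fderiv ℝ X q b⟫ := by
    have h1 := hG.inner ℝ hDX
    have h2 : HasFDerivAt (fun q => ⟪gradient f (X q), fderiv ℝ X q b⟫) (0 : E2 →L[ℝ] ℝ) q := by
      refine (hasFDerivAt_const (0 : ℝ) q).congr_of_eventuallyEq ?_
      filter_upwards [hX.isOpen_source.mem_nhds hq] with q' hq'
      exact hfirst q' hq' b
    have h3 := DFunLike.congr_fun (h1.unique h2) a
    simp only [ContinuousLinearMap.comp_apply, ContinuousLinearMap.prod_apply,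
      fderivInnerCLM_apply, ContinuousLinearMap.apply_apply, zero_apply] at h3
    linarith
  have hHess : ‖fderiv ℝ (gradient f) (X q)‖ ≤ H :=
    norm_fderiv_le_of_lip' ℝ hH0 (Filter.Eventually.of_forall fun y => hH y (X q))
  have hfin : Module.finrank ℝ (LinearMap.range (fderiv ℝ X q).toLinearMap) = 2 := by
    rw [LinearMap.finrank_range_of_inj (hX.immersion q hq)]
    simp
  have hNorth : N ∈ (LinearMap.range (fderiv ℝ X q).toLinearMap)ᗮ := by
    rw [Submodule.mem_orthogonal]
    rintro _ ⟨v, rfl⟩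
    rw [real_inner_comm]
    exact hfirst q hq v
  have hkey := norm_starProjection_orthogonal_mul hfin hNorth (fderiv ℝ (fderiv ℝ X) q a b)
  have hbound : |⟪N, fderiv ℝ (fderiv ℝ X) q a b⟫| ≤
      H * ‖fderiv ℝ X q a‖ * ‖fderiv ℝ X q b‖ := by
    rw [hsecond, abs_neg]
    refine (abs_real_inner_le_norm _ _).trans ?_
    gcongr
    exact (ContinuousLinearMap.le_opNorm _ _).trans (by gcongr)
  refine le_of_mul_le_mul_right ?_ hκ
  calc ‖secondFundamentalForm X q a b‖ * κ ≤ ‖secondFundamentalForm X q a b‖ * ‖N‖ := by gcongr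
    _ ≤ H * ‖fderiv ℝ X q a‖ * ‖fderiv ℝ X q b‖ := hkey.trans_le hbound
    _ ≤ K * κ * ‖fderiv ℝ X q a‖ * ‖fderiv ℝ X q b‖ := by gcongr
    _ = _ := by ring

end LevelSets

/-! ### The approximate calibration of a minimal connection -/

section Calibration

open scoped RealInnerProductSpace
open Real (smoothTransition)

variable {k : ℕ}

lemma norm_sub_le_configDiam (p n : Fin k → E3) (i j : Fin k) : ‖p i - n j‖ ≤ configDiam p n := by
  rw [← dist_eq_norm]
  exact Metric.dist_le_diam_of_mem
    ((Set.finite_range p).union (Set.finite_range n)).isBounded (Or.inl ⟨i, rfl⟩) (Or.inr ⟨j, rfl⟩)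

lemma norm_sub_le_configDiam_left (p n : Fin k → E3) (i j : Fin k) :
    ‖p i - p j‖ ≤ configDiam p n := by
  rw [← dist_eq_norm]
  exact Metric.dist_le_diam_of_mem
    ((Set.finite_range p).union (Set.finite_range n)).isBounded (Or.inl ⟨i, rfl⟩) (Or.inl ⟨j, rfl⟩)

lemma configDiam_nonneg (p n : Fin k → E3) : 0 ≤ configDiam p n := Metric.diam_nonneg

lemma exists_config_prices [NeZero k] {p n : Fin k → E3}
    (h : minConnLength p n = ∑ i, ‖p i - n i‖) :
    ∃ a b : Fin k → ℝ, (∀ i j, a i - b j ≤ ‖p i - n j‖) ∧ ∀ i, a i - b i = ‖p i - n i‖ :=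
  exists_dual_prices (c := fun i j => ‖p i - n j‖) fun σ => by
    rw [← h]
    exact Finset.inf'_le _ (Finset.mem_univ σ)

lemma exists_unit_inner_eq_norm (d : E3) : ∃ v : E3, ‖v‖ = 1 ∧ ⟪v, d⟫ = ‖d‖ := by
  rcases eq_or_ne d 0 with rfl | hd
  · obtain ⟨v, hv, -, -⟩ := exists_unit_normal 0 0
    exact ⟨v, hv, by simp⟩
  · have hd' : ‖d‖ ≠ 0 := norm_ne_zero_iff.2 hd
    refine ⟨‖d‖⁻¹ • d, ?_, ?_⟩
    · rw [norm_smul, norm_inv, norm_norm, inv_mul_cancel₀ hd']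
    · rw [real_inner_smul_left, real_inner_self_eq_norm_sq]
      field_simp

/-- The smooth version of `max_i min_j (a i + ⟪w (i, j), x - p i⟫)`, where the `w (i, j)` are
perturbations of the directions of `p i - n j` in general position. It is at least about `a i` at
`p i`, and at most about `b j` at `n j`, because the `(i, j)`-th affine function is. -/
lemma exists_softSelection_of_config [NeZero k] {p n : Fin k → E3}
    (h : minConnLength p n = ∑ i, ‖p i - n i‖) {B : ℝ}
    (hB : ∀ x y : ℝ, |smoothTransition x - smoothTransition y| ≤ B * |x - y|) {s R : ℝ}
    (hs : 0 < s) (hR : 32 * s * ((k : ℝ) ^ 4 + 1) ≤ R) (hR8 : R ≤ 1 / 8) :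
    ∃ w : Fin k × Fin k → E3, (∀ α, ‖w α‖ ≤ 1) ∧ GeneralPosition w Finset.univ s ∧
      ∀ μ : ℝ, 0 < μ → ∃ (c : Fin k × Fin k → ℝ) (f : E3 → ℝ),
        SoftSelection w c (2 * k * μ) (2 * k * (4 * B / μ)) f ∧
        ∑ i, ‖p i - n i‖ - k * (2 * R * configDiam p n + 2 * (k * μ)) ≤
          ∑ i, (f (p i) - f (n i)) := by
  obtain ⟨a, b, hab, hab'⟩ := exists_config_prices h
  choose v hv hvd using exists_unit_inner_eq_norm
  have hcard : ((Fintype.card (Fin k × Fin k) : ℕ) : ℝ) ^ 2 = (k : ℝ) ^ 4 := by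
    simp
    ring
  obtain ⟨w, hw1, hwv, hgp⟩ := exists_generalPosition
    (v := fun α : Fin k × Fin k => v (p α.1 - n α.2)) (fun α => hv _) hs
    (by rw [hcard]; exact hR) hR8
  refine ⟨w, hw1, hgp, fun μ hμ => ?_⟩
  set c : Fin k × Fin k → ℝ := fun α => a α.1 - ⟪w α, p α.1⟫ with hc
  obtain ⟨f, hf, hlow, hup⟩ := SoftSelection.exists_max_min c hw1 hB hμ
  rw [Fintype.card_fin] at hf hlow hup
  refine ⟨c, f, hf, ?_⟩
  have hR0 : 0 ≤ R := le_trans (by positivity) hR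
  have hp : ∀ i, a i - k * μ ≤ f (p i) := by
    intro i
    obtain ⟨j, hj⟩ := hlow (p i) i
    simp only [hc] at hj
    linarith
  have hn : ∀ j, f (n j) ≤ b j + 2 * R * configDiam p n + k * μ := by
    intro j
    obtain ⟨i, hi⟩ := hup (n j) j
    have h1 : ⟪w (i, j) - v (p i - n j), p i - n j⟫ ≥ -(2 * R * configDiam p n) := by
      have h2 := abs_real_inner_le_norm (w (i, j) - v (p i - n j)) (p i - n j)
      have h3 : ‖w (i, j) - v (p i - n j)‖ * ‖p i - n j‖ ≤ 2 * R * configDiam p n :=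
        mul_le_mul (hwv (i, j)) (norm_sub_le_configDiam p n i j) (norm_nonneg _) (by positivity)
      exact (neg_le_neg (h2.trans h3)).trans (neg_abs_le _)
    rw [inner_sub_left, hvd, inner_sub_right] at h1
    simp only [hc] at hi
    linarith [hab i j]
  have hterm : ∀ i ∈ Finset.univ, ‖p i - n i‖ - (2 * R * configDiam p n + 2 * (k * μ)) ≤
      f (p i) - f (n i) := fun i _ => by linarith [hp i, hn i, hab' i]
  have hsum := Finset.sum_le_sum hterm
  rwa [Finset.sum_sub_distrib, Finset.sum_const, Finset.card_univ, Fintype.card_fin,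
    nsmul_eq_mul] at hsum

lemma sum_sub_le_sum_norm {f : E3 → ℝ} (hf : Differentiable ℝ f)
    (hgrad : ∀ x, ‖gradient f x‖ ≤ 1) (p n : Fin k → E3) :
    ∑ i, (f (p i) - f (n i)) ≤ ∑ i, ‖p i - n i‖ :=
  Finset.sum_le_sum fun i _ =>
    (le_abs_self _).trans (abs_sub_le_of_norm_gradient_le hf hgrad (p i) (n i))

/-- The range of admissible parameters, in terms of `s = lam ^ ρ`. -/
lemma parameter_bounds (hk : 1 ≤ k) {ρ lam : ℝ} (hρ : 0 < ρ) (hρ2 : ρ < 1 / 2) (hlam : 0 < lam)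
    (h : lam < (1 / 8 * ((2 * (k : ℝ)) ^ 6)⁻¹) ^ (1 / ρ)) :
    0 < lam ^ ρ ∧ lam ^ ρ * (512 * (k : ℝ) ^ 6) < 1 ∧ lam ≤ (lam ^ ρ) ^ 2 ∧
      lam ^ (2 * ρ) = (lam ^ ρ) ^ 2 := by
  have hk1 : (1 : ℝ) ≤ k := by exact_mod_cast hk
  have hk6 : (1 : ℝ) ≤ (k : ℝ) ^ 6 := one_le_pow₀ hk1
  set q : ℝ := 1 / 8 * ((2 * (k : ℝ)) ^ 6)⁻¹ with hq
  have hq0 : 0 < q := by positivity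
  have hqk : q * (512 * (k : ℝ) ^ 6) = 1 := by
    rw [hq]
    field_simp
    norm_num
  have hq1 : q < 1 := by nlinarith
  have h2 : lam ^ (2 * ρ) = (lam ^ ρ) ^ 2 := by
    rw [mul_comm, Real.rpow_mul hlam.le, Real.rpow_two]
  have hlam1 : lam ≤ 1 := (h.trans (Real.rpow_lt_one hq0.le hq1 (by positivity))).le
  have hs : lam ^ ρ < q := by
    have h1 := Real.rpow_lt_rpow hlam.le h hρ
    rwa [← Real.rpow_mul hq0.le, one_div, inv_mul_cancel₀ hρ.ne', Real.rpow_one] at h1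
  refine ⟨by positivity, ?_, ?_, h2⟩
  · rw [← hqk]
    gcongr
  · rw [← h2]
    have := Real.rpow_le_rpow_of_exponent_ge hlam hlam1 (by linarith : 2 * ρ ≤ 1)
    rwa [Real.rpow_one] at this

lemma abs_sin_sub_le {t : ℝ} (ht : |t| ≤ 1) : |Real.sin t - t| ≤ |t| ^ 3 := by
  have h1 := Real.sin_bound ht
  have h2 : |Real.sin t - t| ≤ |Real.sin t - (t - t ^ 3 / 6)| + |t ^ 3 / 6| := by
    have := abs_add_le (Real.sin t - (t - t ^ 3 / 6)) (-(t ^ 3 / 6))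
    rw [abs_neg] at this
    convert! this using 2
    ring
  rw [abs_div, abs_pow, abs_of_pos (by norm_num : (0 : ℝ) < 6)] at h2
  have h3 : |t| ^ 5 ≤ |t| ^ 3 := pow_le_pow_of_le_one (abs_nonneg t) ht (by norm_num)
  have h4 : 0 ≤ |t| ^ 3 := by positivity
  linarith

/-- The composition of a function `f` with `y ↦ lam * sin ((y - β) / lam)` has small range, its
gradient is no longer than that of `f`, and it is close to `f - β` where `f` is close to `β`. -/
lemma exists_small_range_modification {f : E3 → ℝ} (hf : ContDiff ℝ ∞ f)
    (hgrad : ∀ x, ‖gradient f x‖ ≤ 1) (β : ℝ) {lam : ℝ} (hlam : 0 < lam) :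
    ∃ ζ : E3 → ℝ, ContDiff ℝ ∞ ζ ∧ (∀ x, ‖gradient ζ x‖ ≤ 1) ∧ (∀ x, |ζ x| ≤ lam) ∧
      ∀ x, ∀ D ≤ lam, |f x - β| ≤ D → |ζ x - (f x - β)| ≤ D * (D / lam) ^ 2 := by
  refine ⟨fun x => lam * Real.sin (lam⁻¹ * (f x - β)), ?_, fun x => ?_, fun x => ?_,
    fun x D hD hx => ?_⟩
  · exact contDiff_const.mul
      (Real.contDiff_sin.comp (contDiff_const.mul (hf.sub contDiff_const)))
  · have h1 : HasFDerivAt (fun x => lam * Real.sin (lam⁻¹ * (f x - β)))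
        (lam • (Real.cos (lam⁻¹ * (f x - β)) • (lam⁻¹ • fderiv ℝ f x))) x :=
      (((hf.differentiable (by simp) x).hasFDerivAt.sub_const β).const_mul lam⁻¹).sin.const_mul lam
    rw [norm_gradient_eq_norm_fderiv, h1.fderiv, smul_comm lam, smul_inv_smul₀ hlam.ne', norm_smul,
      ← norm_gradient_eq_norm_fderiv]
    exact mul_le_one₀ (Real.abs_cos_le_one _) (norm_nonneg _) (hgrad x)
  · rw [abs_mul, abs_of_pos hlam]
    exact mul_le_of_le_one_right hlam.le (Real.abs_sin_le_one _)
  · set t := lam⁻¹ * (f x - β) with ht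
    have hft : f x - β = lam * t := by
      rw [ht, mul_inv_cancel_left₀ hlam.ne']
    have htD : |t| ≤ D / lam := by
      rw [ht, abs_mul, abs_of_pos (inv_pos.2 hlam), div_eq_inv_mul]
      gcongr
    have ht1 : |t| ≤ 1 := htD.trans ((div_le_one hlam).2 hD)
    rw [hft, ← mul_sub, abs_mul, abs_of_pos hlam]
    calc lam * |Real.sin t - t| ≤ lam * (D / lam) ^ 3 := by
          gcongr
          exact (abs_sin_sub_le ht1).trans (by gcongr)
      _ = D * (D / lam) ^ 2 := by
          field_simp

/-- For a configuration that is small compared with `lam`, there is an approximate calibration all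
of whose values lie in an interval of length `2 * lam`. -/
lemma exists_calibration_small_range [NeZero k] {p n : Fin k → E3}
    (h : minConnLength p n = ∑ i, ‖p i - n i‖) {s lam : ℝ} (hs : 0 < s) (hlam : 0 < lam)
    (hsk : s * (512 * (k : ℝ) ^ 6) < 1) (hlams : lam ≤ s ^ 2)
    (hsmall : configDiam p n * s < lam ^ 2) :
    ∃ ζ : E3 → ℝ, ContDiff ℝ ∞ ζ ∧ (∀ x, ‖gradient ζ x‖ ≤ 1) ∧ (∀ x, |ζ x| ≤ lam) ∧
      ∑ i, ‖p i - n i‖ - 4 * configDiam p n * (2 * (k : ℝ)) ^ 6 * s ≤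
        ∑ i, (ζ (p i) - ζ (n i)) := by
  set D := configDiam p n with hD
  have hD0 : 0 ≤ D := configDiam_nonneg p n
  have hk1 : (1 : ℝ) ≤ k := by exact_mod_cast Nat.one_le_iff_ne_zero.2 (NeZero.ne k)
  rcases hD0.eq_or_lt with hDz | hDpos
  · refine ⟨fun _ => 0, contDiff_const, fun x => ?_, fun x => by simpa using hlam.le, ?_⟩
    · rw [gradient_fun_const]
      simp
    · have hz : ∀ i, ‖p i - n i‖ = 0 := fun i =>
        le_antisymm ((norm_sub_le_configDiam p n i i).trans_eq hDz.symm) (norm_nonneg _)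
      simp [hz, ← hDz]
  have hk46 : (k : ℝ) ^ 4 ≤ (k : ℝ) ^ 6 := pow_le_pow_right₀ hk1 (by norm_num)
  have hk4 : (1 : ℝ) ≤ (k : ℝ) ^ 4 := one_le_pow₀ hk1
  obtain ⟨B, hB0, hB⟩ := exists_lipschitz_smoothTransition
  obtain ⟨w, hw, -, hμ⟩ := exists_softSelection_of_config h hB hs (R := 64 * s * (k : ℝ) ^ 4)
    (by nlinarith) (by nlinarith)
  -- The Lipschitz constant of the gradient plays no role, so the smoothing scale may be small.
  obtain ⟨c, f, hf, hsum⟩ := hμ (D * s) (by positivity)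
  have hgrad := hf.norm_gradient_le hw
  have hdiff : Differentiable ℝ f := hf.contDiff.differentiable (by simp)
  obtain ⟨ζ, hζ, hζgrad, hζlam, hζf⟩ :=
    exists_small_range_modification hf.contDiff hgrad (f (p 0)) hlam
  have hs1 : s ≤ 1 := by nlinarith
  -- Since `lam ≤ s ^ 2`, smallness means `D < lam ^ (3 / 2)`.
  have hD3 : D ^ 2 ≤ lam ^ 3 := by
    have h1 : (D * s) ^ 2 ≤ (lam ^ 2) ^ 2 := by gcongr
    have h2 : D ^ 2 * lam ≤ D ^ 2 * s ^ 2 := by gcongr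
    have h3 : D ^ 2 * lam ≤ lam ^ 3 * lam := by linarith [mul_pow D s 2]
    exact le_of_mul_le_mul_right h3 hlam
  have hlam1 : lam ≤ s := by nlinarith
  have hDlam2 : (D / lam) ^ 2 ≤ s := by
    rw [div_pow, div_le_iff₀ (by positivity)]
    calc D ^ 2 ≤ lam ^ 3 := hD3
      _ = lam * lam ^ 2 := by ring
      _ ≤ s * lam ^ 2 := by gcongr
  have hDlam : D ≤ lam := by
    have h1 : D ^ 2 ≤ lam ^ 2 := by
      have h2 : s * lam ^ 2 ≤ 1 * lam ^ 2 := by gcongr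
      have h3 : lam * lam ^ 2 ≤ s * lam ^ 2 := by gcongr
      linarith [pow_succ' lam 2]
    exact (pow_le_pow_iff_left₀ hD0 hlam.le (by norm_num)).1 h1
  have hp : ∀ i, |ζ (p i) - (f (p i) - f (p 0))| ≤ D * s := fun i =>
    (hζf (p i) D hDlam ((abs_sub_le_of_norm_gradient_le hdiff hgrad _ _).trans
      (norm_sub_le_configDiam_left p n i 0))).trans (by gcongr)
  have hn : ∀ i, |ζ (n i) - (f (n i) - f (p 0))| ≤ D * s := fun i =>
    (hζf (n i) D hDlam ((abs_sub_le_of_norm_gradient_le hdiff hgrad _ _).trans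
      ((norm_sub_rev _ _).trans_le (norm_sub_le_configDiam p n 0 i)))).trans (by gcongr)
  refine ⟨ζ, hζ, hζgrad, hζlam, ?_⟩
  have hterm : ∀ i ∈ Finset.univ, f (p i) - f (n i) - 2 * (D * s) ≤ ζ (p i) - ζ (n i) :=
    fun i _ => by linarith [(abs_le.1 (hp i)).1, (abs_le.1 (hn i)).2]
  have hsum' := Finset.sum_le_sum hterm
  rw [Finset.sum_sub_distrib, Finset.sum_const, Finset.card_univ, Fintype.card_fin,
    nsmul_eq_mul] at hsum'
  have hDs : 0 ≤ D * s := by positivity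
  have e1 : (k : ℝ) ^ 5 * (D * s) ≤ (k : ℝ) ^ 6 * (D * s) := by
    gcongr
    norm_num
  have e2 : (k : ℝ) ^ 2 * (D * s) ≤ (k : ℝ) ^ 6 * (D * s) := by
    gcongr
    norm_num
  have e3 : (k : ℝ) * (D * s) ≤ (k : ℝ) ^ 6 * (D * s) := by
    gcongr
    exact le_self_pow₀ hk1 (by norm_num)
  have e4 : 0 ≤ (k : ℝ) ^ 6 * (D * s) := by positivity
  nlinarith

lemma isSmoothSurface_empty : IsSmoothSurface ∅ := fun _ hx => absurd hx (Set.notMem_empty _)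

lemma isIntrinsicallyComplete_empty : IsIntrinsicallyComplete ∅ :=
  fun _ hu => absurd (hu 0) (Set.notMem_empty _)

lemma secondFundamentalFormBoundedBy_empty (K : ℝ) : SecondFundamentalFormBoundedBy ∅ K := by
  intro U X hX q hq
  obtain ⟨V, -, hV⟩ := hX.image_eq
  have : X q ∈ (∅ : Set E3) ∩ V := hV ▸ Set.mem_image_of_mem X hq
  exact absurd this.1 (Set.notMem_empty _)

lemma volume_image_le_of_abs_le {ζ : E3 → ℝ} {lam : ℝ} (hk : 1 ≤ k) (hlam : 0 < lam)
    (h : ∀ x, |ζ x| ≤ lam) (P : Set E3) :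
    MeasureTheory.volume (ζ '' P) ≤ ENNReal.ofReal (2 * lam * (k : ℝ) ^ 2) := by
  have hk2 : (1 : ℝ) ≤ (k : ℝ) ^ 2 := one_le_pow₀ (by exact_mod_cast hk)
  have hsub : ζ '' P ⊆ Set.Icc (-lam) lam := by
    rintro _ ⟨x, -, rfl⟩
    exact abs_le.1 (h x)
  refine (MeasureTheory.measure_mono hsub).trans ?_
  rw [Real.volume_Icc]
  refine ENNReal.ofReal_le_ofReal ?_
  nlinarith

end Calibration

end MinConn

theorem proposition5p1 :
    ∃ C C₀ C₁ : ℝ, 0 < C ∧ 0 < C₀ ∧ 0 < C₁ ∧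
      ∀ (k : ℕ), 1 ≤ k → ∀ (p n : Fin k → MinConn.E3),
        MinConn.minConnLength p n = ∑ i, ‖p i - n i‖ →
        ∀ ρ : ℝ, 0 < ρ → ρ < 1 / 2 →
        ∀ lam : ℝ, 0 < lam → lam < (C₀ * ((2 * (k : ℝ)) ^ 6)⁻¹) ^ (1 / ρ) →
          ∃ ζ : MinConn.E3 → ℝ, ContDiff ℝ ∞ ζ ∧
            |MinConn.minConnLength p n - ∑ i, (ζ (p i) - ζ (n i))|
              ≤ C * MinConn.configDiam p n * (2 * (k : ℝ)) ^ 6 * lam ^ ρ ∧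
            (∀ x, ‖gradient ζ x‖ ≤ 1) ∧
            ∃ P : Set MinConn.E3,
              MeasureTheory.volume (ζ '' P) ≤ ENNReal.ofReal (2 * lam * (k : ℝ) ^ 2) ∧
              ∀ κ : ℝ, 0 < κ → κ < lam ^ (2 * ρ) / 3 →
                ∃ centers : Finset MinConn.E3, centers.card ≤ (2 * k) ^ 8 ∧
                  {x | ‖gradient ζ x‖ < κ} \ P ⊆
                    (⋃ c ∈ centers, Metric.ball c (C * lam / (lam ^ (2 * ρ) - 3 * κ))) ∧
                  ∀ t : ℝ,
                    t ∉ ζ '' (⋃ c ∈ centers,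
                      Metric.ball c (C * lam / (lam ^ (2 * ρ) - 3 * κ))) ∪ ζ '' P →
                    MinConn.IsSmoothSurface {x | ζ x = t} ∧
                    MinConn.IsIntrinsicallyComplete {x | ζ x = t} ∧
                    MinConn.SecondFundamentalFormBoundedBy {x | ζ x = t}
                      (C₁ * (lam ^ 2 * κ)⁻¹) := by
  obtain ⟨B, hB0, hB⟩ := MinConn.exists_lipschitz_smoothTransition
  refine ⟨4, 1 / 8, 4 * B, by norm_num, by norm_num, by positivity, ?_⟩
  intro k hk p n h ρ hρ hρ2 lam hlam hlamq
  have hkz : NeZero k := ⟨by omega⟩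
  obtain ⟨hs, hsk, hlams, h2ρ⟩ := MinConn.parameter_bounds hk hρ hρ2 hlam hlamq
  set s := lam ^ ρ with hsdef
  set D := MinConn.configDiam p n with hD
  have hD0 : 0 ≤ D := MinConn.configDiam_nonneg p n
  have hk1 : (1 : ℝ) ≤ k := by exact_mod_cast hk
  rw [h2ρ, h]
  have hbound0 : 0 ≤ 4 * D * (2 * (k : ℝ)) ^ 6 * s := by positivity
  rcases lt_or_ge (D * s) (lam ^ 2) with hsmall | hlarge
  · -- All values of `ζ` are exceptional, and the remaining level sets are empty.
    obtain ⟨ζ, hζ, hgrad, hrange, hsum⟩ :=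
      MinConn.exists_calibration_small_range h hs hlam hsk hlams hsmall
    have hup := MinConn.sum_sub_le_sum_norm (hζ.differentiable (by simp)) hgrad p n
    refine ⟨ζ, hζ, abs_le.2 ⟨by linarith, by linarith⟩, hgrad, Set.univ,
      MinConn.volume_image_le_of_abs_le hk hlam hrange _, fun κ _ _ => ⟨∅, by simp, by simp, ?_⟩⟩
    intro t ht
    have hempty : {x | ζ x = t} = ∅ := Set.eq_empty_of_forall_notMem fun x hx =>
      ht (Or.inr ⟨x, Set.mem_univ x, hx⟩)
    rw [hempty]
    exact ⟨MinConn.isSmoothSurface_empty, MinConn.isIntrinsicallyComplete_empty,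
      MinConn.secondFundamentalFormBoundedBy_empty _⟩
  · have hk46 : (k : ℝ) ^ 4 ≤ (k : ℝ) ^ 6 := pow_le_pow_right₀ hk1 (by norm_num)
    have hk4 : (1 : ℝ) ≤ (k : ℝ) ^ 4 := one_le_pow₀ hk1
    obtain ⟨w, hw, hgp, hμ⟩ := MinConn.exists_softSelection_of_config h hB hs
      (R := 64 * s * (k : ℝ) ^ 4) (by nlinarith) (by nlinarith)
    -- The smoothing scale `2 k lam ^ 2` makes the Lipschitz constant of the gradient `4 B / lam ^ 2`.
    obtain ⟨c, ζ, hζ, hsum⟩ := hμ (2 * k * lam ^ 2) (by positivity)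
    have hgrad := hζ.norm_gradient_le hw
    have hup := MinConn.sum_sub_le_sum_norm (hζ.contDiff.differentiable (by simp)) hgrad p n
    have hlow : ∑ i, ‖p i - n i‖ - 4 * D * (2 * (k : ℝ)) ^ 6 * s ≤
        ∑ i, (ζ (p i) - ζ (n i)) := by
      have e0 : 0 ≤ D * s := by positivity
      have e1 : (k : ℝ) ^ 5 * (D * s) ≤ (k : ℝ) ^ 6 * (D * s) := by
        gcongr
        norm_num
      have e2 : (k : ℝ) ^ 3 * lam ^ 2 ≤ (k : ℝ) ^ 6 * (D * s) := by
        gcongr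
        norm_num
      have e3 : 0 ≤ (k : ℝ) ^ 6 * (D * s) := by positivity
      nlinarith
    refine ⟨ζ, hζ.contDiff, abs_le.2 ⟨by linarith, by linarith⟩, hgrad, ∅, by simp, ?_⟩
    intro κ hκ hκs
    have hgap : 0 < s ^ 2 - 3 * κ := by linarith
    have hr : 4 * (2 * k * (2 * k * lam ^ 2)) <
        4 * lam / (s ^ 2 - 3 * κ) * (s ^ 2 - κ) := by
      have h1 : 4 * (2 * k * (2 * k * lam ^ 2)) < 4 * lam := by
        have h2 : (k : ℝ) ^ 2 ≤ (k : ℝ) ^ 6 := pow_le_pow_right₀ hk1 (by norm_num)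
        have h3 : s ≤ 1 := by nlinarith
        have h4 : lam ≤ s := by nlinarith
        have h5 : lam * (k : ℝ) ^ 2 ≤ s * (k : ℝ) ^ 6 := by gcongr
        have h6 : 4 * (lam * (k : ℝ) ^ 2) < 1 := by linarith
        nlinarith
      have h2 : 4 * lam = 4 * lam / (s ^ 2 - 3 * κ) * (s ^ 2 - 3 * κ) := by
        field_simp
      refine h1.trans_le (h2.trans_le ?_)
      gcongr
      linarith
    obtain ⟨centers, hcard, hcover⟩ := hζ.exists_cover hgp (by linarith) hr
    refine ⟨centers, hcard.trans ?_, Set.sdiff_subset.trans hcover, fun t ht => ?_⟩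
    · rw [Fintype.card_prod, Fintype.card_fin]
      calc (k * k) ^ 4 = k ^ 8 := by ring
        _ ≤ (2 * k) ^ 8 := Nat.pow_le_pow_left (by omega) 8
    · have hreg : ∀ x, ζ x = t → κ ≤ ‖gradient ζ x‖ := by
        intro x hx
        by_contra! hlt
        exact ht (Or.inl ⟨x, hcover hlt, hx⟩)
      have hsurf := MinConn.isSmoothSurface_levelSet hζ.contDiff (t := t) fun x hx h0 => by
        have := hreg x hx
        rw [h0, norm_zero] at this
        linarith
      refine ⟨hsurf, hsurf.isIntrinsicallyComplete
        (isClosed_eq hζ.contDiff.continuous continuous_const), ?_⟩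
      refine MinConn.secondFundamentalFormBoundedBy_levelSet hζ.contDiff hκ hreg
        hζ.gradient_lipschitz (by positivity) (le_of_eq ?_)
      have hk0 : (k : ℝ) ≠ 0 := by positivity
      field_simp
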